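/- Let $\mathfrak g_5$ be an indecomposable (i.e. not the direct sum of two non-zero ideals) five-dimensional real Lie algebra, let $\mathfrak g=\mathfrak g_5\oplus\mathbb R$ (direct sum of Lie algebras, $\mathbb R$ abelian), and let $\rho\in\Lambda^3\mathfrak g^*$ be closed, $d\rho=0$, where $d$ is the Chevalley–Eilenberg differential with trivial coefficients, $d\alpha(X,Y)=-\alpha([X,Y])$ on one-forms. The quartic invariant of $\rho$ is $\lambda(\rho)=\frac16\operatorname{tr}K_\rho^2\in(\Lambda^6\mathfrak g^*)^{\otimes2}$, where $K_\rho(v)=\kappa\big((v\lrcorner\rho)\wedge\rho\big)\in\mathfrak g\otimes\Lambda^6\mathfrak g^*$ and $\kappa:\Lambda^5\mathfrak g^*\to\mathfrak g\otimes\Lambda^6\mathfrak g^*$ is the isomorphism $\kappa(\xi)=X\otimes\nu$ with $X\lrcorner\nu=\xi$. As $(\Lambda^6\mathfrak g^*)^{\otimes2}$ is the square of a real line, its sign is well defined: $\lambda(\rho)\ge0$ (resp. $=0$) means $\lambda(\rho)=c\,\nu\otimes\nu$ with $c\ge0$ (resp. $c=0$) for every non-zero $\nu\in\Lambda^6\mathfrak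 g^*$. The nilradical $\mathrm{nil}(\mathfrak g_5)$ is the largest nilpotent ideal, and $\mathrm h^3(\mathfrak g_5)$ is the dimension of the third Lie algebra cohomology group $H^3(\mathfrak g_5)$. (i) $\lambda(\rho)\ge0$ if $\mathfrak g_5$ is isomorphic to one of the following Lie algebras with basis $e_1,\dots,e_5$ (all parameters are real; brackets of basis vectors that are not determined by those listed are zero). Algebras with abelian ideal $\langle e_1,\dots,e_4\rangle$; listed are the brackets $[e_i,e_5]$: - $A_{5,7}^{\alpha,\beta,\gamma}$: $[e_1,e_5]=e_1$, $[e_2,e_5]=\alpha e_2$, $[e_3,e_5]=\beta e_3$, $[e_4,e_5]=\gamma e_4$, with $\alpha\beta\gamma\ne0$ and such that, writing $(\mu_1,\mu_2,\mu_3,\mu_4)=(1,\alpha,\beta,\gamma)$, for all $\{i,j,k,l\}=\{1,2,3,4\}$ with $\mu_i+\mu_j=0$ one has $\mu_k+\mu_l\ne0$ and $\mu_k+\mu_l\neq\mu_i$; - $A_{5,8}^{\gamma}$: $[e_2,e_5]=e_1$, $[e_3,e_5]=e_3$, $[e_4,e_5]=\gamma e_4$, with $\gamma\notin\{0,-1\}$;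 - $A_{5,9}^{\beta,\gamma}$: $[e_1,e_5]=e_1$, $[e_2,e_5]=e_1+e_2$, $[e_3,e_5]=\beta e_3$, $[e_4,e_5]=\gamma e_4$, with $\beta\gamma\neq0$ and $(\beta,\gamma)\notin\{(-1,-2),(-2,-1),(2,-2),(-2,2)\}$; - $A_{5,10}$: $[e_2,e_5]=e_1$, $[e_3,e_5]=e_2$, $[e_4,e_5]=e_4$; - $A_{5,11}^{\gamma}$: $[e_1,e_5]=e_1$, $[e_2,e_5]=e_1+e_2$, $[e_3,e_5]=e_2+e_3$, $[e_4,e_5]=\gamma e_4$, with $\gamma\ne0$; - $A_{5,12}$: $[e_1,e_5]=e_1$, $[e_2,e_5]=e_1+e_2$, $[e_3,e_5]=e_2+e_3$, $[e_4,e_5]=e_3+e_4$; - $A_{5,13}^{\alpha,\beta,\gamma}$: $[e_1,e_5]=e_1$, $[e_2,e_5]=\alpha e_2$, $[e_3,e_5]=\beta e_3-\gamma e_4$, $[e_4,e_5]=\gamma e_3+\beta e_4$, with $\alpha\gamma\neq0$ and not ($\alpha=-1$ and $\beta\in\{0,\frac12,-\frac12\}$); - $A_{5,14}^{\alpha}$: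 $[e_2,e_5]=e_1$, $[e_3,e_5]=\alpha e_3-e_4$, $[e_4,e_5]=e_3+\alpha e_4$, with $\alpha\ne0$; - $A_{5,15}^{\alpha}$: $[e_1,e_5]=e_1$, $[e_2,e_5]=e_1+e_2$, $[e_3,e_5]=\alpha e_3$, $[e_4,e_5]=e_3+\alpha e_4$, with $\alpha\ne-1$; - $A_{5,16}^{\alpha,\beta}$: $[e_1,e_5]=e_1$, $[e_2,e_5]=e_1+e_2$, $[e_3,e_5]=\alpha e_3-\beta e_4$, $[e_4,e_5]=\beta e_3+\alpha e_4$, with $\beta\ne0$; - $A_{5,17}^{\alpha,\beta,\gamma}$: $[e_1,e_5]=\alpha e_1-e_2$, $[e_2,e_5]=e_1+\alpha e_2$, $[e_3,e_5]=\beta e_3-\gamma e_4$, $[e_4,e_5]=\gamma e_3+\beta e_4$, with $\gamma\ne0$, $(\alpha,\beta)\ne(0,0)$ and not ($\beta=-\alpha$ and $\gamma=\pm1$); - $A_{5,18}^{\alpha}$: $[e_1,e_5]=\alpha e_1-e_2$, $[e_2,e_5]=e_1+\alpha e_2$, $[e_3,e_5]=e_1+\alpha e_3-e_4$, $[e_4,e_5]=e_2+e_3+\alpha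 e_4$, with $\alpha\ne0$. Algebras with ideal $\mathfrak h_3\oplus\mathbb R=\langle e_1,\dots,e_4\rangle$; in each case $[e_2,e_3]=e_1$, and in addition: - $A_{5,19}^{\alpha,\beta}$: $[e_1,e_5]=\alpha e_1$, $[e_2,e_5]=e_2$, $[e_3,e_5]=(\alpha-1)e_3$, $[e_4,e_5]=\beta e_4$, with $\beta\ne0$, $\alpha\notin\{-1,\frac12\}$, $\beta\notin\{-\alpha-1,\,1-2\alpha\}$; - $A_{5,20}^{\alpha}$: $[e_1,e_5]=\alpha e_1$, $[e_2,e_5]=e_2$, $[e_3,e_5]=(\alpha-1)e_3$, $[e_4,e_5]=e_1+\alpha e_4$, with $\alpha\notin\{-\frac12,\frac13\}$; - $A_{5,21}$: $[e_1,e_5]=2e_1$, $[e_2,e_5]=e_2+e_3$, $[e_3,e_5]=e_3+e_4$, $[e_4,e_5]=e_4$; - $A_{5,23}^{\beta}$: $[e_1,e_5]=2e_1$, $[e_2,e_5]=e_2+e_3$, $[e_3,e_5]=e_3$, $[e_4,e_5]=\beta e_4$, with $\beta\notin\{0,-3\}$; - $A_{5,24}^{\epsilon}$: $[e_1,e_5]=2e_1$,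 $[e_2,e_5]=e_2+e_3$, $[e_3,e_5]=e_3$, $[e_4,e_5]=\epsilon e_1+2e_4$, with $\epsilon=\pm1$; - $A_{5,25}^{\beta,\alpha}$: $[e_1,e_5]=2\alpha e_1$, $[e_2,e_5]=\alpha e_2+e_3$, $[e_3,e_5]=-e_2+\alpha e_3$, $[e_4,e_5]=\beta e_4$, with $\beta\ne0$; - $A_{5,26}^{\alpha,\epsilon}$: $[e_1,e_5]=2\alpha e_1$, $[e_2,e_5]=\alpha e_2+e_3$, $[e_3,e_5]=-e_2+\alpha e_3$, $[e_4,e_5]=\epsilon e_1+2\alpha e_4$, with $\epsilon=\pm1$; - $A_{5,27}$: $[e_1,e_5]=e_1$, $[e_3,e_5]=e_3+e_4$, $[e_4,e_5]=e_1+e_4$; - $A_{5,28}^{\alpha}$: $[e_1,e_5]=\alpha e_1$, $[e_2,e_5]=(\alpha-1)e_2$, $[e_3,e_5]=e_3+e_4$, $[e_4,e_5]=e_4$, with $\alpha\notin\{-2,-1,0,\frac12\}$; - $A_{5,29}$: $[e_1,e_5]=e_1$, $[e_2,e_5]=e_2$, $[e_3,e_5]=e_4$. (ii) If $\mathrm{nil}(\mathfrak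 g_5)\cong\mathbb R^4$ (abelian) and $\mathrm h^3(\mathfrak g_5)=0$, then $\lambda(\rho)=0$. -/

import Mathlib

open Module

/- The abelian Lie algebra `ℝ` is `ℝ` with the (vanishing) commutator bracket. -/
attribute [local instance] LieRing.ofAssociativeRing

noncomputable section

namespace HalfFlat

/-! ## Forms on a Lie algebra and Lie algebra cohomology -/

section Cohomology

variable (L : Type*) [LieRing L] [LieAlgebra ℝ L]

/-- The Chevalley-Eilenberg differential on `(p+1)`-forms (trivial coefficients)
`dω(x₀,…,x_{p+1}) = ∑_{k < l} (-1)^{k+l} ω([x_k, x_l], x₀, …, x̂_k, …, x̂_l, …, x_{p+1})`.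
The pair `k < l` is written `k = i.castSucc`, `l = j.succ` with `i ≤ j`, whence the sign `-1` in
front of the sum. For one-forms this is `dα(X,Y) = - α([X,Y])`. -/
def ceD (p : ℕ) : (L [⋀^Fin (p + 1)]→ₗ[ℝ] ℝ) →ₗ[ℝ] ((Fin (p + 2) → L) → ℝ) where
  toFun ω x := - ∑ i : Fin (p + 1), ∑ j ≥ i, (-1 : ℝ) ^ ((i : ℕ) + (j : ℕ)) *
    ω (Matrix.vecCons ⁅x i.castSucc, x j.succ⁆ (j.removeNth (i.castSucc.removeNth x)))
  map_add' ω η := by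
    funext x
    simp only [AlternatingMap.add_apply, mul_add, Finset.sum_add_distrib, Pi.add_apply, neg_add]
  map_smul' c ω := by
    funext x
    simp only [AlternatingMap.smul_apply, smul_eq_mul, Pi.smul_apply, RingHom.id_apply,
      mul_left_comm _ c, ← Finset.mul_sum, mul_neg]

/-- The closed `(p+1)`-forms. -/
def cocycles (p : ℕ) : Submodule ℝ (L [⋀^Fin (p + 1)]→ₗ[ℝ] ℝ) := LinearMap.ker (ceD L p)

/-- The exact `(p+2)`-forms. -/
def coboundaries (p : ℕ) : Submodule ℝ (L [⋀^Fin (p + 2)]→ₗ[ℝ] ℝ) where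
  carrier := {ω | ∃ η : L [⋀^Fin (p + 1)]→ₗ[ℝ] ℝ, ceD L p η = ω}
  add_mem' := by
    rintro ω ω' ⟨η, h⟩ ⟨η', h'⟩
    exact ⟨η + η', by rw [map_add, h, h']; rfl⟩
  zero_mem' := ⟨0, by rw [map_zero]; rfl⟩
  smul_mem' := by
    rintro c ω ⟨η, h⟩
    exact ⟨c • η, by rw [map_smul, h]; rfl⟩

/-- `h³(L)`, the dimension of the third Lie algebra cohomology group `H³(L)`: the space of classes
of closed three-forms modulo exact three-forms. -/
def h3 : ℕ :=
  finrank ℝ ((cocycles L 2).map (coboundaries L 1).mkQ)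

/-! ## Structure of a Lie algebra -/

/-- The nilradical: the largest ideal which is nilpotent as a Lie algebra. -/
def nilradical : LieIdeal ℝ L := sSup {I : LieIdeal ℝ L | LieRing.IsNilpotent I}

/-- The nilradical is isomorphic to the abelian Lie algebra `ℝ⁴`. -/
def NilradicalIsR4 : Prop :=
  IsLieAbelian (nilradical L) ∧ finrank ℝ (nilradical L) = 4

/-- `L` is not the direct sum of two non-zero ideals. -/
def Indecomposable : Prop :=
  Nontrivial L ∧ ∀ I J : LieIdeal ℝ L, IsCompl I J → I = ⊥ ∨ J = ⊥

end Cohomology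

/-! ## The quartic invariant of a three-form in dimension six -/

section Quartic

variable {V : Type*} [AddCommGroup V] [Module ℝ V]

/-- The wedge product of forms (the sum over shuffles). -/
def wedge {p q : ℕ} (α : V [⋀^Fin p]→ₗ[ℝ] ℝ) (β : V [⋀^Fin q]→ₗ[ℝ] ℝ) :
    V [⋀^Fin (p + q)]→ₗ[ℝ] ℝ :=
  ((LinearMap.mul' ℝ ℝ).compAlternatingMap (α.domCoprod β)).domDomCongr finSumFinEquiv

/-- For the volume form `ν = b.det`, the map `X ↦ X ⌟ ν` is an isomorphism `V → Λ⁵V*`. -/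
theorem hook_bijective (b : Basis (Fin 6) ℝ V) :
    Function.Bijective (b.det.curryLeft : V →ₗ[ℝ] V [⋀^Fin 5]→ₗ[ℝ] ℝ) := by
  have : Module.Finite ℝ V := Module.Finite.of_basis b
  have hinj : Function.Injective (b.det.curryLeft : V →ₗ[ℝ] V [⋀^Fin 5]→ₗ[ℝ] ℝ) := by
    rw [injective_iff_map_eq_zero]
    intro v hv
    by_contra hne
    have hli : LinearIndepOn ℝ id ({v} : Set V) := by
      rw [linearIndepOn_singleton_iff]
      exact hne
    have e : ∃ c : Basis (Fin 6) ℝ V, c 0 = v := by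
      let B := Basis.extend hli
      have : Fintype (hli.extend (Set.subset_univ _)) := FiniteDimensional.fintypeBasisIndex B
      have hc : Fintype.card (hli.extend (Set.subset_univ _)) = 6 := by
        rw [← finrank_eq_card_basis B, finrank_eq_card_basis b, Fintype.card_fin]
      have hmem : v ∈ hli.extend (Set.subset_univ _) :=
        hli.subset_extend _ (Set.mem_singleton v)
      let f := Fintype.equivFinOfCardEq hc
      let g := f.trans (Equiv.swap (f ⟨v, hmem⟩) 0)
      refine ⟨B.reindex g, ?_⟩
      have : g.symm 0 = ⟨v, hmem⟩ := by
        rw [Equiv.symm_apply_eq]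
        simp [g]
      rw [Basis.reindex_apply, this, Basis.extend_apply_self]
    obtain ⟨c, rfl⟩ := e
    have h1 : b.det c = 0 := by
      have := DFunLike.congr_fun hv (Matrix.vecTail c)
      rw [AlternatingMap.curryLeft_apply_apply] at this
      have hc : Matrix.vecCons (c 0) (Matrix.vecTail c) = c := Matrix.cons_head_tail _
      rw [hc] at this
      exact this
    exact (b.isUnit_det c).ne_zero h1
  have hfin : finrank ℝ V = finrank ℝ (V [⋀^Fin 5]→ₗ[ℝ] ℝ) := by
    rw [(exteriorPower.alternatingMapLinearEquiv (R := ℝ) (M := V) (N := ℝ) (n := 5)).finrank_eq,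
      Module.finrank_linearMap_self, exteriorPower.finrank_eq, finrank_eq_card_basis b,
      Fintype.card_fin]
    rfl
  have : Module.Finite ℝ (V [⋀^Fin 5]→ₗ[ℝ] ℝ) :=
    Module.Finite.equiv
      (exteriorPower.alternatingMapLinearEquiv (R := ℝ) (M := V) (N := ℝ) (n := 5)).symm
  exact ⟨hinj, (LinearMap.injective_iff_surjective_of_finrank_eq_finrank hfin).1 hinj⟩

/-- The canonical isomorphism `κ : Λ⁵V* → V ⊗ Λ⁶V*` in the trivialisation of `Λ⁶V*` by the volume
form `ν = b.det`: `κ(ξ) = X ⊗ ν` with `X ⌟ ν = ξ`. -/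
def kappa (b : Basis (Fin 6) ℝ V) : (V [⋀^Fin 5]→ₗ[ℝ] ℝ) ≃ₗ[ℝ] V :=
  (LinearEquiv.ofBijective b.det.curryLeft (hook_bijective b)).symm

theorem wedge_add_left {p q : ℕ} (α α' : V [⋀^Fin p]→ₗ[ℝ] ℝ) (β : V [⋀^Fin q]→ₗ[ℝ] ℝ) :
    wedge (α + α') β = wedge α β + wedge α' β := by
  have h : (α + α').domCoprod β = α.domCoprod β + α'.domCoprod β := by
    have := congrArg AlternatingMap.domCoprod' (TensorProduct.add_tmul α α' β)
    simpa only [map_add, AlternatingMap.domCoprod'_apply] using this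
  ext v
  simp [wedge, h]

theorem wedge_smul_left {p q : ℕ} (c : ℝ) (α : V [⋀^Fin p]→ₗ[ℝ] ℝ) (β : V [⋀^Fin q]→ₗ[ℝ] ℝ) :
    wedge (c • α) β = c • wedge α β := by
  have h : (c • α).domCoprod β = c • α.domCoprod β := by
    have := congrArg AlternatingMap.domCoprod' (TensorProduct.smul_tmul' c α β)
    simpa only [map_smul, AlternatingMap.domCoprod'_apply] using this.symm
  ext v
  simp [wedge, h]

/-- The endomorphism `K_ρ(v) = κ((v ⌟ ρ) ∧ ρ)`, in the trivialisation of `Λ⁶V*` by `b.det`. -/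
def K (b : Basis (Fin 6) ℝ V) (ρ : V [⋀^Fin 3]→ₗ[ℝ] ℝ) : V →ₗ[ℝ] V where
  toFun v := kappa b (wedge (ρ.curryLeft v) ρ)
  map_add' v w := by rw [map_add, wedge_add_left, map_add]
  map_smul' c v := by rw [map_smul, wedge_smul_left, map_smul]; rfl

/-- The quartic invariant `λ(ρ) = (1/6) tr K_ρ²`, an element of the square of the line `Λ⁶V*`, in
the trivialisation by the volume form `ν = b.det`: this is the real number `c` with
`λ(ρ) = c • ν ⊗ ν`. -/
def quartic (b : Basis (Fin 6) ℝ V) (ρ : V [⋀^Fin 3]→ₗ[ℝ] ℝ) : ℝ :=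
  (1 / 6 : ℝ) * LinearMap.trace ℝ V (K b ρ ∘ₗ K b ρ)

/-- `λ(ρ) ≥ 0` in `(Λ⁶V*)^{⊗2}`: it is a non-negative multiple of `ν ⊗ ν` for every volume form
`ν`. -/
def LambdaNonneg (ρ : V [⋀^Fin 3]→ₗ[ℝ] ℝ) : Prop :=
  ∀ b : Basis (Fin 6) ℝ V, 0 ≤ quartic b ρ

/-- `λ(ρ) = 0` in `(Λ⁶V*)^{⊗2}`. -/
def LambdaZero (ρ : V [⋀^Fin 3]→ₗ[ℝ] ℝ) : Prop :=
  ∀ b : Basis (Fin 6) ℝ V, quartic b ρ = 0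

end Quartic

/-! ## The five-dimensional Lie algebras of the table -/

section Table

/-- The matrices of the marked algebras with abelian ideal `⟨e₁,…,e₄⟩`; the `i`-th row is
`[e_i, e₅]` in terms of `e₁,…,e₄`. -/
inductive MarkedR4 : Matrix (Fin 4) (Fin 4) ℝ → Prop
  /-- `A_{5,7}^{α,β,γ}`, with eigenvalues `μ = (1, α, β, γ)`. -/
  | A7 (μ : Fin 4 → ℝ) (hone : μ 0 = 1) (hne : ∀ i, μ i ≠ 0)
      (h : ∀ i j k l : Fin 4, [i, j, k, l].Nodup → μ i + μ j = 0 →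
        μ k + μ l ≠ 0 ∧ μ k + μ l ≠ μ i) :
      MarkedR4 (Matrix.diagonal μ)
  /-- `A_{5,8}^{γ}`. -/
  | A8 (γ : ℝ) (h0 : γ ≠ 0) (h : γ ≠ -1) :
      MarkedR4 !![0, 0, 0, 0; 1, 0, 0, 0; 0, 0, 1, 0; 0, 0, 0, γ]
  /-- `A_{5,9}^{β,γ}`. -/
  | A9 (β γ : ℝ) (hβ : β ≠ 0) (hγ : γ ≠ 0)
      (h1 : ¬ (β = -1 ∧ γ = -2)) (h2 : ¬ (β = -2 ∧ γ = -1))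
      (h3 : ¬ (β = 2 ∧ γ = -2)) (h4 : ¬ (β = -2 ∧ γ = 2)) :
      MarkedR4 !![1, 0, 0, 0; 1, 1, 0, 0; 0, 0, β, 0; 0, 0, 0, γ]
  /-- `A_{5,10}`. -/
  | A10 : MarkedR4 !![0, 0, 0, 0; 1, 0, 0, 0; 0, 1, 0, 0; 0, 0, 0, 1]
  /-- `A_{5,11}^{γ}`. -/
  | A11 (γ : ℝ) (h0 : γ ≠ 0) :
      MarkedR4 !![1, 0, 0, 0; 1, 1, 0, 0; 0, 1, 1, 0; 0, 0, 0, γ]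
  /-- `A_{5,12}`. -/
  | A12 : MarkedR4 !![1, 0, 0, 0; 1, 1, 0, 0; 0, 1, 1, 0; 0, 0, 1, 1]
  /-- `A_{5,13}^{α,β,γ}`. -/
  | A13 (α β γ : ℝ) (hα : α ≠ 0) (hγ : γ ≠ 0)
      (h : ¬ (α = -1 ∧ (β = 0 ∨ β = 1 / 2 ∨ β = -1 / 2))) :
      MarkedR4 !![1, 0, 0, 0; 0, α, 0, 0; 0, 0, β, -γ; 0, 0, γ, β]
  /-- `A_{5,14}^{α}`. -/
  | A14 (α : ℝ) (h : α ≠ 0) :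
      MarkedR4 !![0, 0, 0, 0; 1, 0, 0, 0; 0, 0, α, -1; 0, 0, 1, α]
  /-- `A_{5,15}^{α}`. -/
  | A15 (α : ℝ) (h : α ≠ -1) :
      MarkedR4 !![1, 0, 0, 0; 1, 1, 0, 0; 0, 0, α, 0; 0, 0, 1, α]
  /-- `A_{5,16}^{α,β}`. -/
  | A16 (α β : ℝ) (h : β ≠ 0) :
      MarkedR4 !![1, 0, 0, 0; 1, 1, 0, 0; 0, 0, α, -β; 0, 0, β, α]
  /-- `A_{5,17}^{α,β,γ}`. -/
  | A17 (α β γ : ℝ) (hγ : γ ≠ 0) (h1 : ¬ (α = 0 ∧ β = 0))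
      (h2 : ¬ (β = -α ∧ (γ = 1 ∨ γ = -1))) :
      MarkedR4 !![α, -1, 0, 0; 1, α, 0, 0; 0, 0, β, -γ; 0, 0, γ, β]
  /-- `A_{5,18}^{α}`. -/
  | A18 (α : ℝ) (h : α ≠ 0) :
      MarkedR4 !![α, -1, 0, 0; 1, α, 0, 0; 1, 0, α, -1; 0, 1, 1, α]

/-- The matrices of the marked algebras with ideal `𝔥₃ ⊕ ℝ = ⟨e₁,…,e₄⟩`, `[e₂, e₃] = e₁`; the
`i`-th row is `[e_i, e₅]` in terms of `e₁,…,e₄`. -/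
inductive MarkedH3R : Matrix (Fin 4) (Fin 4) ℝ → Prop
  /-- `A_{5,19}^{α,β}`. -/
  | A19 (α β : ℝ) (hβ : β ≠ 0) (h1 : α ≠ -1) (h2 : α ≠ 1 / 2)
      (h3 : β ≠ -α - 1) (h4 : β ≠ 1 - 2 * α) :
      MarkedH3R !![α, 0, 0, 0; 0, 1, 0, 0; 0, 0, α - 1, 0; 0, 0, 0, β]
  /-- `A_{5,20}^{α}`. -/
  | A20 (α : ℝ) (h1 : α ≠ -1 / 2) (h2 : α ≠ 1 / 3) :
      MarkedH3R !![α, 0, 0, 0; 0, 1, 0, 0; 0, 0, α - 1, 0; 1, 0, 0, α]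
  /-- `A_{5,21}`. -/
  | A21 : MarkedH3R !![2, 0, 0, 0; 0, 1, 1, 0; 0, 0, 1, 1; 0, 0, 0, 1]
  /-- `A_{5,23}^{β}`. -/
  | A23 (β : ℝ) (hβ : β ≠ 0) (h : β ≠ -3) :
      MarkedH3R !![2, 0, 0, 0; 0, 1, 1, 0; 0, 0, 1, 0; 0, 0, 0, β]
  /-- `A_{5,24}^{ε}`. -/
  | A24 (ε : ℝ) (hε : ε = 1 ∨ ε = -1) :
      MarkedH3R !![2, 0, 0, 0; 0, 1, 1, 0; 0, 0, 1, 0; ε, 0, 0, 2]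
  /-- `A_{5,25}^{β,α}`. -/
  | A25 (β α : ℝ) (hβ : β ≠ 0) :
      MarkedH3R !![2 * α, 0, 0, 0; 0, α, 1, 0; 0, -1, α, 0; 0, 0, 0, β]
  /-- `A_{5,26}^{α,ε}`. -/
  | A26 (α ε : ℝ) (hε : ε = 1 ∨ ε = -1) :
      MarkedH3R !![2 * α, 0, 0, 0; 0, α, 1, 0; 0, -1, α, 0; ε, 0, 0, 2 * α]
  /-- `A_{5,27}`. -/
  | A27 : MarkedH3R !![1, 0, 0, 0; 0, 0, 0, 0; 0, 0, 1, 1; 1, 0, 0, 1]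
  /-- `A_{5,28}^{α}`. -/
  | A28 (α : ℝ) (h1 : α ≠ -2) (h2 : α ≠ -1) (h3 : α ≠ 0) (h4 : α ≠ 1 / 2) :
      MarkedH3R !![α, 0, 0, 0; 0, α - 1, 0, 0; 0, 0, 1, 1; 0, 0, 0, 1]
  /-- `A_{5,29}`. -/
  | A29 : MarkedH3R !![1, 0, 0, 0; 0, 1, 0, 0; 0, 0, 0, 1; 0, 0, 0, 0]

variable (L : Type*) [LieRing L] [LieAlgebra ℝ L]

/-- In the basis `e = (e₁,…,e₅)` (indexed from `0`) the Lie bracket of `L` is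
`[e₂, e₃] = c e₁`, `[e_i, e₅] = ∑_j A_{ij} e_j` for `i, j ≤ 4`, and all other brackets of basis
vectors (up to skew-symmetry) vanish. -/
structure HasBrackets {L : Type*} [LieRing L] [LieAlgebra ℝ L]
    (e : Basis (Fin 5) ℝ L) (c : ℝ) (A : Matrix (Fin 4) (Fin 4) ℝ) : Prop where
  ad : ∀ i : Fin 4, ⁅e i.castSucc, e 4⁆ = ∑ j : Fin 4, A i j • e j.castSucc
  b23 : ⁅e 1, e 2⁆ = c • e 0
  b12 : ⁅e 0, e 1⁆ = 0
  b13 : ⁅e 0, e 2⁆ = 0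
  b14 : ⁅e 0, e 3⁆ = 0
  b24 : ⁅e 1, e 3⁆ = 0
  b34 : ⁅e 2, e 3⁆ = 0

/-- `L` is isomorphic to one of the Lie algebras marked in the column `λ ≥ 0` of the table. -/
def Marked : Prop :=
  ∃ (e : Basis (Fin 5) ℝ L) (A : Matrix (Fin 4) (Fin 4) ℝ),
    (MarkedR4 A ∧ HasBrackets e 0 A) ∨ (MarkedH3R A ∧ HasBrackets e 1 A)

end Table

end HalfFlat

end

/-!
Write `V = L ⊕ ℝ` with basis `e₁,…,e₆`, where `⟨e₁,…,e₄⟩` is the ideal of `L` on which `e₅` acts by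
the matrix `A` and `e₆` spans the abelian summand, and decompose
`ρ = ψ + σ ∧ e⁵ + ω ∧ e⁶ + β ∧ e⁵⁶` with `ψ, σ, ω, β` forms on `⟨e₁,…,e₄⟩`. Let `x` be the vector with
`ψ = x ⌟ e¹²³⁴`. Expanding `tr K_ρ²` (`quartic_eq`) gives
`λ(ρ) = (β(x) + σ ∧ ω)² - 4 Pf(ω) Pf(σ) + 4 (x ⌟ ω) ∧ σ ∧ β`.
The sign does not depend on the basis (`exists_quartic_eq_mul`).

For the algebras of the table, closedness of `ρ` is a linear system relating `ψ` and `ω` to the action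
of `A` (`HasBrackets.closedComp`): when the ideal is abelian `A` annihilates both, and when it is
`𝔥₃ ⊕ ℝ` it does so up to one component each. Non-zero solutions need vanishing sums of eigenvalues
of `A`; the conditions on the parameters leave only those for which `Pf(ω) = 0` and
`x ⌟ ω = 0` (`MarkedR4.degenerate`, `MarkedH3R.degenerate`). Then `λ(ρ)` is a square.

If the nilradical is `ℝ⁴` and `H³(L) = 0`, then `ψ` is the restriction of an exact form to an abelian
ideal, so it vanishes. All forms `σ ∧ e⁵` are closed, hence exact, so the action of `A` on `Λ²` of the
dual of the ideal is surjective, therefore injective, and `ω`, which it annihilates, vanishes as well.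
With `x = 0` and `ω = 0` the formula gives `λ(ρ) = 0` (`lambdaZero_of_h3_eq_zero`).
-/

noncomputable section

namespace HalfFlat

/-! ### The wedge product of a two-form and a three-form -/

section Wedge

open Equiv

variable {V : Type*} [AddCommGroup V] [Module ℝ V]

/-- For `a < b` the permutation of `Fin 2 ⊕ Fin 3 ≃ Fin 5` sending the first two indices to `a, b`.
These ten permutations represent the cosets over which the wedge product of a two-form and a
three-form is summed. The last three indices are in general not sent to an increasing triple. -/
def shuffle (p : Fin 5 × Fin 5) : Perm (Fin 2 ⊕ Fin 3) :=
  finSumFinEquiv.symm.permCongr (swap 0 p.1 * swap 1 p.2)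

theorem sign_shuffle (p : Fin 5 × Fin 5) :
    Perm.sign (shuffle p) = (if p.1 = 0 then 1 else -1) * (if p.2 = 1 then 1 else -1) := by
  simp only [shuffle, Perm.sign_permCongr, Perm.sign_mul, Perm.sign_swap',
    eq_comm (b := (0 : Fin 5)), eq_comm (b := (1 : Fin 5))]

/-- The pair `a < b` is determined by the coset of `shuffle (a, b)`: membership of `(shuffle p)⁻¹ *
shuffle q` in the subgroup preserving the two blocks forces `p = q`. -/
theorem shuffle_injective_mod : ∀ p q : Fin 5 × Fin 5, p.1 < p.2 → q.1 < q.2 →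
    (∀ i : Fin 2, ((shuffle p)⁻¹ (shuffle q (Sum.inl i))).isLeft) → p = q := by
  decide

/-- Every coset is represented by a `shuffle`; a coset only depends on the images `a, b` of the first
two indices. -/
theorem exists_shuffle : ∀ a b : Fin 2 ⊕ Fin 3, a ≠ b → ∃ p : Fin 5 × Fin 5, p.1 < p.2 ∧
    ((shuffle p)⁻¹ a).isLeft ∧ ((shuffle p)⁻¹ b).isLeft := by
  decide

theorem isLeft_of_mem_range_sumCongrHom {τ : Perm (Fin 2 ⊕ Fin 3)}
    (h : τ ∈ (Perm.sumCongrHom (Fin 2) (Fin 3)).range) (i : Fin 2) :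
    (τ (Sum.inl i)).isLeft := by
  obtain ⟨⟨a, b⟩, rfl⟩ := h
  simp

theorem wedge_eq_sum_shuffle (α : V [⋀^Fin 2]→ₗ[ℝ] ℝ) (β : V [⋀^Fin 3]→ₗ[ℝ] ℝ) (v : Fin 5 → V) :
    wedge α β v = ∑ p : Fin 5 × Fin 5 with p.1 < p.2,
      ((Perm.sign (shuffle p) : ℤ) : ℝ) * (α (fun i => v (finSumFinEquiv (shuffle p (Sum.inl i)))) *
        β (fun i => v (finSumFinEquiv (shuffle p (Sum.inr i))))) := by
  have : wedge α β v = ∑ σ : Perm.ModSumCongr (Fin 2) (Fin 3), LinearMap.mul' ℝ ℝ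
      (AlternatingMap.domCoprod.summand α β σ (fun i => v (finSumFinEquiv i))) := by
    simp [wedge, AlternatingMap.domCoprod, Function.comp_def]
  rw [this]
  symm
  refine Finset.sum_bij (fun p _ => (Quotient.mk'' (shuffle p) : Perm.ModSumCongr (Fin 2) (Fin 3)))
    (fun _ _ => Finset.mem_univ _) ?_ ?_ ?_
  · intro p hp q hq h
    rw [Quotient.eq'', QuotientGroup.leftRel_apply] at h
    exact shuffle_injective_mod p q (by simpa using hp) (by simpa using hq)
      fun i => by simpa only [Perm.mul_apply] using isLeft_of_mem_range_sumCongrHom h i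
  · intro σ _
    induction σ using Quotient.inductionOn' with | _ σ
    obtain ⟨p, hp, h0, h1⟩ := exists_shuffle (σ (Sum.inl 0)) (σ (Sum.inl 1)) (by simp)
    refine ⟨p, by simpa using hp, ?_⟩
    rw [Quotient.eq'', QuotientGroup.leftRel_apply]
    refine Perm.mem_sumCongrHom_range_of_perm_mapsTo_inl ?_
    rintro _ ⟨i, rfl⟩
    have : ((shuffle p)⁻¹ (σ (Sum.inl i))).isLeft := by
      fin_cases i
      · exact h0
      · exact h1
    obtain ⟨j, hj⟩ := Sum.isLeft_iff.1 this
    exact ⟨j, hj.symm⟩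
  · intro p hp
    rw [AlternatingMap.domCoprod.summand_mk'']
    rcases Int.units_eq_one_or (Perm.sign (shuffle p)) with h | h <;> simp [h]

theorem map_swap_left (ρ : V [⋀^Fin 3]→ₗ[ℝ] ℝ) (x y z : V) : ρ ![y, x, z] = - ρ ![x, y, z] := by
  rw [← ρ.map_swap ![x, y, z] (show (0 : Fin 3) ≠ 1 by decide)]
  congr 1; ext i; fin_cases i <;> simp [swap_apply_of_ne_of_ne]

theorem map_swap_right (ρ : V [⋀^Fin 3]→ₗ[ℝ] ℝ) (x y z : V) : ρ ![x, z, y] = - ρ ![x, y, z] := by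
  rw [← ρ.map_swap ![x, y, z] (show (1 : Fin 3) ≠ 2 by decide)]
  congr 1; ext i; fin_cases i <;> simp [swap_apply_of_ne_of_ne]

theorem map_self_left (ρ : V [⋀^Fin 3]→ₗ[ℝ] ℝ) (x z : V) : ρ ![x, x, z] = 0 :=
  ρ.map_eq_zero_of_eq _ (show ![x, x, z] 0 = ![x, x, z] 1 from rfl) (by decide)

theorem map_self_right (ρ : V [⋀^Fin 3]→ₗ[ℝ] ℝ) (x z : V) : ρ ![x, z, z] = 0 :=
  ρ.map_eq_zero_of_eq _ (show ![x, z, z] 1 = ![x, z, z] 2 from rfl) (by decide)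

theorem wedge_two_three_apply (α : V [⋀^Fin 2]→ₗ[ℝ] ℝ) (β : V [⋀^Fin 3]→ₗ[ℝ] ℝ) (v : Fin 5 → V) :
    wedge α β v = α ![v 0, v 1] * β ![v 2, v 3, v 4] - α ![v 0, v 2] * β ![v 1, v 3, v 4]
      + α ![v 0, v 3] * β ![v 1, v 2, v 4] - α ![v 0, v 4] * β ![v 1, v 2, v 3]
      + α ![v 1, v 2] * β ![v 0, v 3, v 4] - α ![v 1, v 3] * β ![v 0, v 2, v 4]
      + α ![v 1, v 4] * β ![v 0, v 2, v 3] + α ![v 2, v 3] * β ![v 0, v 1, v 4]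
      - α ![v 2, v 4] * β ![v 0, v 1, v 3] + α ![v 3, v 4] * β ![v 0, v 1, v 2] := by
  have swaps : ∀ p : Fin 5 × Fin 5, p.1 < p.2 →
      swap 0 p.1 (swap 1 p.2 0) = p.1 ∧ swap 0 p.1 (swap 1 p.2 1) = p.2 := by decide
  have summand : ∀ p : Fin 5 × Fin 5, p.1 < p.2 → ((Perm.sign (shuffle p) : ℤ) : ℝ) *
        (α (fun i => v (finSumFinEquiv (shuffle p (Sum.inl i)))) *
          β (fun i => v (finSumFinEquiv (shuffle p (Sum.inr i))))) =
      (if p.1 = 0 then 1 else -1) * (if p.2 = 1 then 1 else -1) * (α ![v p.1, v p.2] *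
        β ![v (swap 0 p.1 (swap 1 p.2 2)), v (swap 0 p.1 (swap 1 p.2 3)),
          v (swap 0 p.1 (swap 1 p.2 4))]) := by
    intro p hp
    have h1 : (fun i => v (finSumFinEquiv (shuffle p (Sum.inl i)))) = ![v p.1, v p.2] := by
      ext i
      fin_cases i
      · simp only [shuffle, permCongr_apply, symm_symm, apply_symm_apply]
        exact congrArg v (swaps p hp).1
      · simp only [shuffle, permCongr_apply, symm_symm, apply_symm_apply]
        exact congrArg v (swaps p hp).2
    have h2 : (fun i => v (finSumFinEquiv (shuffle p (Sum.inr i)))) =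
        ![v (swap 0 p.1 (swap 1 p.2 2)), v (swap 0 p.1 (swap 1 p.2 3)),
          v (swap 0 p.1 (swap 1 p.2 4))] := by
      ext i
      fin_cases i <;> simp [shuffle] <;> rfl
    rw [sign_shuffle p, h1, h2]
    split_ifs <;> simp
  have pairs : (Finset.univ.filter fun p : Fin 5 × Fin 5 => p.1 < p.2) =
      {(0, 1), (0, 2), (0, 3), (0, 4), (1, 2), (1, 3), (1, 4), (2, 3), (2, 4), (3, 4)} := by
    decide
  rw [wedge_eq_sum_shuffle, Finset.sum_congr rfl (fun p hp => summand p (by simpa using hp)), pairs]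
  simp [Finset.sum_insert, swap_apply_def]
  rw [map_swap_left β (v 1) (v 2) (v 4), map_swap_right β (v 2) (v 1) (v 3),
    map_swap_left β (v 1) (v 2) (v 3), map_swap_left β (v 0) (v 2) (v 4),
    map_swap_right β (v 2) (v 0) (v 3), map_swap_left β (v 0) (v 2) (v 3),
    map_swap_right β (v 0) (v 1) (v 3), map_swap_left β (v 0) (v 2) (v 1),
    map_swap_right β (v 0) (v 1) (v 2)]
  ring

end Wedge

/-! ### The quartic invariant in coordinates -/

section QuarticFormula

variable {V : Type*} [AddCommGroup V] [Module ℝ V]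

theorem curryLeft_det_kappa (b : Basis (Fin 6) ℝ V) (ξ : V [⋀^Fin 5]→ₗ[ℝ] ℝ) :
    b.det.curryLeft (kappa b ξ) = ξ :=
  (LinearEquiv.ofBijective b.det.curryLeft (hook_bijective b)).apply_symm_apply ξ

/-- The `i`-th coordinate of `X` is, up to sign, `X ⌟ ν` evaluated on the basis without `b_i`. -/
theorem repr_kappa (b : Basis (Fin 6) ℝ V) (ξ : V [⋀^Fin 5]→ₗ[ℝ] ℝ) (i : Fin 6) :
    b.repr (kappa b ξ) i = (-1) ^ (i : ℕ) * ξ (fun k => b (i.succAbove k)) := by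
  have h : ∀ j, b.det.curryLeft (b j) (fun k => b (i.succAbove k)) =
      if j = i then (-1) ^ (i : ℕ) else 0 := by
    intro j
    rw [AlternatingMap.curryLeft_apply_apply]
    split_ifs with hj
    · subst hj
      have : Matrix.vecCons (b j) (fun k => b (j.succAbove k)) = b ∘ j.cycleRange.symm := by
        ext k
        refine Fin.cases ?_ (fun k => ?_) k <;> simp
      rw [this, AlternatingMap.map_perm, Basis.det_self, Equiv.Perm.sign_symm, Fin.sign_cycleRange]
      simp [Units.smul_def]
    · obtain ⟨k, hk⟩ := Fin.exists_succAbove_eq hj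
      refine AlternatingMap.map_eq_zero_of_eq _ _ (i := 0) (j := k.succ) ?_ (Fin.succ_ne_zero k).symm
      simp [hk]
  have hξ : ξ (fun k => b (i.succAbove k)) = ∑ j, b.repr (kappa b ξ) j *
      b.det.curryLeft (b j) (fun k => b (i.succAbove k)) := by
    conv_lhs => rw [← curryLeft_det_kappa b ξ]
    generalize kappa b ξ = X
    let ev : V →ₗ[ℝ] ℝ :=
      { toFun := fun v => b.det.curryLeft v (fun k => b (i.succAbove k))
        map_add' := fun v w => by rw [map_add]; rfl
        map_smul' := fun c v => by rw [map_smul]; rfl }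
    change ev X = ∑ j, b.repr X j * ev (b j)
    conv_lhs => rw [← b.sum_repr X, map_sum]
    simp only [map_smul, smul_eq_mul]
  rw [hξ]
  simp only [h]
  simp [mul_comm _ ((-1 : ℝ) ^ (i : ℕ)), ← mul_assoc, ← mul_pow]

/-- Since `K_ρ` scales by the inverse of the ratio of two volume forms, `λ(ρ)` scales by a square, so
that its sign can be read off in one adapted basis. -/
theorem exists_quartic_eq_mul (b b' : Basis (Fin 6) ℝ V) (ρ : V [⋀^Fin 3]→ₗ[ℝ] ℝ) :
    ∃ c : ℝ, quartic b' ρ = c ^ 2 * quartic b ρ := by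
  have hdet : b'.det = b'.det b • b.det := by
    simpa using  AlternatingMap.eq_smul_basis_det b b'.det
  have hc : b'.det b ≠ 0 := (b'.isUnit_det b).ne_zero
  have hK : K b' ρ = (b'.det b)⁻¹ • K b ρ := by
    ext v
    refine (hook_bijective b').1 ?_
    change b'.det.curryLeft (kappa b' _) = b'.det.curryLeft ((b'.det b)⁻¹ • kappa b _)
    rw [map_smul, curryLeft_det_kappa, hdet]
    ext w
    have := DFunLike.congr_fun (curryLeft_det_kappa b (wedge (ρ.curryLeft v) ρ)) w
    rw [AlternatingMap.curryLeft_apply_apply] at this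
    simp [AlternatingMap.curryLeft_apply_apply, this, Basis.det_self, hc]
  refine ⟨(b'.det b)⁻¹, ?_⟩
  rw [quartic, quartic, hK, LinearMap.smul_comp, LinearMap.comp_smul, map_smul, map_smul]
  simp only [smul_eq_mul]
  ring

/-- The components `ρ(b_i, b_j, b_k)` of a three-form. -/
def comp {n : ℕ} (b : Basis (Fin n) ℝ V) (ρ : V [⋀^Fin 3]→ₗ[ℝ] ℝ) (i j k : Fin n) : ℝ :=
  ρ ![b i, b j, b k]

theorem repr_K (b : Basis (Fin 6) ℝ V) (ρ : V [⋀^Fin 3]→ₗ[ℝ] ℝ) (i j : Fin 6) :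
    b.repr (K b ρ (b j)) i = (-1) ^ (i : ℕ) *
      (comp b ρ j (i.succAbove 0) (i.succAbove 1) *
          comp b ρ (i.succAbove 2) (i.succAbove 3) (i.succAbove 4)
        - comp b ρ j (i.succAbove 0) (i.succAbove 2) *
          comp b ρ (i.succAbove 1) (i.succAbove 3) (i.succAbove 4)
        + comp b ρ j (i.succAbove 0) (i.succAbove 3) *
          comp b ρ (i.succAbove 1) (i.succAbove 2) (i.succAbove 4)
        - comp b ρ j (i.succAbove 0) (i.succAbove 4) *
          comp b ρ (i.succAbove 1) (i.succAbove 2) (i.succAbove 3)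
        + comp b ρ j (i.succAbove 1) (i.succAbove 2) *
          comp b ρ (i.succAbove 0) (i.succAbove 3) (i.succAbove 4)
        - comp b ρ j (i.succAbove 1) (i.succAbove 3) *
          comp b ρ (i.succAbove 0) (i.succAbove 2) (i.succAbove 4)
        + comp b ρ j (i.succAbove 1) (i.succAbove 4) *
          comp b ρ (i.succAbove 0) (i.succAbove 2) (i.succAbove 3)
        + comp b ρ j (i.succAbove 2) (i.succAbove 3) *
          comp b ρ (i.succAbove 0) (i.succAbove 1) (i.succAbove 4)
        - comp b ρ j (i.succAbove 2) (i.succAbove 4) *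
          comp b ρ (i.succAbove 0) (i.succAbove 1) (i.succAbove 3)
        + comp b ρ j (i.succAbove 3) (i.succAbove 4) *
          comp b ρ (i.succAbove 0) (i.succAbove 1) (i.succAbove 2)) := by
  change b.repr (kappa b (wedge (ρ.curryLeft (b j)) ρ)) i = _
  rw [repr_kappa]
  exact congrArg ((-1 : ℝ) ^ (i : ℕ) * ·)
    (wedge_two_three_apply (ρ.curryLeft (b j)) ρ fun k => b (i.succAbove k))

theorem trace_K_comp_K (b : Basis (Fin 6) ℝ V) (ρ : V [⋀^Fin 3]→ₗ[ℝ] ℝ) :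
    LinearMap.trace ℝ V (K b ρ ∘ₗ K b ρ) =
      ∑ i, ∑ j, b.repr (K b ρ (b j)) i * b.repr (K b ρ (b i)) j := by
  rw [LinearMap.trace_eq_matrix_trace ℝ b, LinearMap.toMatrix_comp b b b, Matrix.trace]
  simp only [Matrix.diag_apply, Matrix.mul_apply, LinearMap.toMatrix_apply]

set_option maxHeartbeats 4000000 in
set_option maxRecDepth 100000 in
/-- The quartic invariant of `ρ = ψ + σ ∧ e⁵ + ω ∧ e⁶ + β ∧ e⁵⁶`, where `ψ, σ, ω, β` are forms on
`⟨e₁,…,e₄⟩` and `ψ = x ⌟ e¹²³⁴`: it is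
`(β(x) + σ ∧ ω)² - 4 Pf(ω) Pf(σ) + 4 (x ⌟ ω) ∧ σ ∧ β`. In terms of the components `T`, indexed from
`0`, the forms `ψ, σ, ω, β` are `T i j k`, `T i j 4`, `T i j 5`, `T i 4 5` with `i, j, k ≤ 3`. -/
theorem quartic_eq (b : Basis (Fin 6) ℝ V) (ρ : V [⋀^Fin 3]→ₗ[ℝ] ℝ) :
    let T := comp b ρ
    quartic b ρ =
      (T 0 4 5 * T 1 2 3 - T 1 4 5 * T 0 2 3 + T 2 4 5 * T 0 1 3 - T 3 4 5 * T 0 1 2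
        + T 0 1 4 * T 2 3 5 + T 2 3 4 * T 0 1 5 - T 0 2 4 * T 1 3 5 - T 1 3 4 * T 0 2 5
        + T 0 3 4 * T 1 2 5 + T 1 2 4 * T 0 3 5) ^ 2
      - 4 * (T 0 1 5 * T 2 3 5 - T 0 2 5 * T 1 3 5 + T 0 3 5 * T 1 2 5) *
          (T 0 1 4 * T 2 3 4 - T 0 2 4 * T 1 3 4 + T 0 3 4 * T 1 2 4)
      + 4 * (T 0 2 3 * T 0 1 5 - T 0 1 3 * T 0 2 5 + T 0 1 2 * T 0 3 5) *
          (T 1 2 4 * T 3 4 5 - T 1 3 4 * T 2 4 5 + T 2 3 4 * T 1 4 5)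
      - 4 * (T 1 2 3 * T 0 1 5 - T 0 1 3 * T 1 2 5 + T 0 1 2 * T 1 3 5) *
          (T 0 2 4 * T 3 4 5 - T 0 3 4 * T 2 4 5 + T 2 3 4 * T 0 4 5)
      + 4 * (T 1 2 3 * T 0 2 5 - T 0 2 3 * T 1 2 5 + T 0 1 2 * T 2 3 5) *
          (T 0 1 4 * T 3 4 5 - T 0 3 4 * T 1 4 5 + T 1 3 4 * T 0 4 5)
      - 4 * (T 1 2 3 * T 0 3 5 - T 0 2 3 * T 1 3 5 + T 0 1 3 * T 2 3 5) *
          (T 0 1 4 * T 2 4 5 - T 0 2 4 * T 1 4 5 + T 1 2 4 * T 0 4 5) := by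
  intro T
  have h1 : ∀ i j k : Fin 6, j < i → comp b ρ i j k = - comp b ρ j i k :=
    fun i j k _ => map_swap_left ρ _ _ _
  have h2 : ∀ i j k : Fin 6, k < j → comp b ρ i j k = - comp b ρ i k j :=
    fun i j k _ => map_swap_right ρ _ _ _
  have h3 : ∀ i k : Fin 6, comp b ρ i i k = 0 := fun i k => map_self_left ρ _ _
  have h4 : ∀ i k : Fin 6, comp b ρ i k k = 0 := fun i k => map_self_right ρ _ _
  rw [quartic, trace_K_comp_K]
  simp only [repr_K, Fin.sum_univ_six]
  simp [Fin.succAbove, h1, h2, h3, h4, T]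
  ring

end QuarticFormula

/-! ### The equations for a closed three-form -/

section Closed

variable {L : Type*} [LieRing L] [LieAlgebra ℝ L]

theorem ceD_one_apply (η : L [⋀^Fin 2]→ₗ[ℝ] ℝ) (x y z : L) :
    ceD L 1 η ![x, y, z] = - η ![⁅x, y⁆, z] + η ![⁅x, z⁆, y] - η ![⁅y, z⁆, x] := by
  have h0 : Finset.Ici (0 : Fin 2) = {0, 1} := by decide
  have h1 : Finset.Ici (1 : Fin 2) = {1} := by decide
  have r : ∀ (j : Fin 2) (i : Fin 3), j.removeNth (i.removeNth ![x, y, z]) =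
      ![![x, y, z] (i.succAbove (j.succAbove 0))] := by
    intro j i
    ext k
    fin_cases k
    rfl
  have r' : Fin.removeNth (1 : Fin 2) ![y, z] = ![y] := by
    ext k
    fin_cases k
    rfl
  simp [ceD, Fin.sum_univ_succ, h0, h1, r, r', Fin.succAbove]
  ring

theorem ceD_two_apply (ρ : L [⋀^Fin 3]→ₗ[ℝ] ℝ) (x y z t : L) :
    ceD L 2 ρ ![x, y, z, t] = - ρ ![⁅x, y⁆, z, t] + ρ ![⁅x, z⁆, y, t] - ρ ![⁅x, t⁆, y, z]
      - ρ ![⁅y, z⁆, x, t] + ρ ![⁅y, t⁆, x, z] - ρ ![⁅z, t⁆, x, y] := by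
  have h0 : Finset.Ici (0 : Fin 3) = {0, 1, 2} := by decide
  have h1 : Finset.Ici (1 : Fin 3) = {1, 2} := by decide
  have h2 : Finset.Ici (2 : Fin 3) = {2} := by decide
  have r : ∀ (j : Fin 3) (i : Fin 4), j.removeNth (i.removeNth ![x, y, z, t]) =
      ![![x, y, z, t] (i.succAbove (j.succAbove 0)),
        ![x, y, z, t] (i.succAbove (j.succAbove 1))] := by
    intro j i
    ext k
    fin_cases k <;> rfl
  have r1 : Fin.removeNth (1 : Fin 3) ![y, z, t] = ![y, t] := by
    ext k
    fin_cases k <;> rfl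
  have r2 : Fin.removeNth (2 : Fin 3) ![y, z, t] = ![y, z] := by
    ext k
    fin_cases k <;> rfl
  simp [ceD, Fin.sum_univ_succ, h0, h1, h2, r, r1, r2, Fin.succAbove]
  ring

theorem map_sum_smul_left {V : Type*} [AddCommGroup V] [Module ℝ V] (ρ : V [⋀^Fin 3]→ₗ[ℝ] ℝ)
    {n : ℕ} (a : Fin n → ℝ) (v : Fin n → V) (y z : V) :
    ρ ![∑ i, a i • v i, y, z] = ∑ i, a i * ρ ![v i, y, z] := by
  let ev : V →ₗ[ℝ] ℝ :=
    { toFun := fun x => ρ.curryLeft x ![y, z]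
      map_add' := fun x x' => by rw [map_add]; rfl
      map_smul' := fun c x => by rw [map_smul]; rfl }
  change ev _ = ∑ i, a i * ev (v i)
  simp only [map_sum, map_smul, smul_eq_mul]

/-- The basis of `L × ℝ` extending a basis of the five-dimensional `L` by a generator of `ℝ`. -/
def prodBasis (e : Basis (Fin 5) ℝ L) : Basis (Fin 6) ℝ (L × ℝ) :=
  (e.prod (Basis.singleton (Fin 1) ℝ)).reindex finSumFinEquiv

theorem prodBasis_castSucc (e : Basis (Fin 5) ℝ L) (i : Fin 5) :
    prodBasis e i.castSucc = (e i, 0) := by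
  have : finSumFinEquiv.symm i.castSucc = (Sum.inl i : Fin 5 ⊕ Fin 1) :=
    finSumFinEquiv_symm_apply_castAdd i
  ext <;> simp [prodBasis, this]

theorem prodBasis_five (e : Basis (Fin 5) ℝ L) : prodBasis e 5 = (0, 1) := by
  have : finSumFinEquiv.symm (5 : Fin 6) = (Sum.inr 0 : Fin 5 ⊕ Fin 1) := rfl
  ext <;> simp [prodBasis, this]

/-- The part used below of the linear equations expressing that a three-form with components `T` on
`L × ℝ` is closed, when `L` has the brackets `HasBrackets e c A`. The fields `twoij` say that the
derivation action of `A` annihilates the two-form `ω = e₆ ⌟ ρ` restricted to `⟨e₁,…,e₄⟩`, up to a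
multiple of `e²³`; the fields `threeijk` say the same for the three-form obtained by restricting `ρ`
to `⟨e₁,…,e₄⟩`, up to a multiple of `e²³⁴`. The field `heis` is the closedness of `ω` on the ideal
itself. -/
structure ClosedComp (c : ℝ) (A : Matrix (Fin 4) (Fin 4) ℝ)
    (T : Fin 6 → Fin 6 → Fin 6 → ℝ) : Prop where
  two01 : (A 0 0 + A 1 1) * T 0 1 5 + A 1 2 * T 0 2 5 + A 1 3 * T 0 3 5 - A 0 2 * T 1 2 5 - A 0 3 * T 1 3 5 = 0
  two02 : A 2 1 * T 0 1 5 + (A 0 0 + A 2 2) * T 0 2 5 + A 2 3 * T 0 3 5 + A 0 1 * T 1 2 5 - A 0 3 * T 2 3 5 = 0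
  two03 : A 3 1 * T 0 1 5 + A 3 2 * T 0 2 5 + (A 0 0 + A 3 3) * T 0 3 5 + A 0 1 * T 1 3 5 + A 0 2 * T 2 3 5 = 0
  two12 : - A 2 0 * T 0 1 5 + A 1 0 * T 0 2 5 + (A 1 1 + A 2 2) * T 1 2 5 + A 2 3 * T 1 3 5 - A 1 3 * T 2 3 5 = c * T 0 4 5
  two13 : - A 3 0 * T 0 1 5 + A 1 0 * T 0 3 5 + A 3 2 * T 1 2 5 + (A 1 1 + A 3 3) * T 1 3 5 + A 1 2 * T 2 3 5 = 0
  two23 : - A 3 0 * T 0 2 5 + A 2 0 * T 0 3 5 - A 3 1 * T 1 2 5 + A 2 1 * T 1 3 5 + (A 2 2 + A 3 3) * T 2 3 5 = 0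
  three012 : (A 0 0 + A 1 1 + A 2 2) * T 0 1 2 + A 2 3 * T 0 1 3 - A 1 3 * T 0 2 3 + A 0 3 * T 1 2 3 = 0
  three013 : A 3 2 * T 0 1 2 + (A 0 0 + A 1 1 + A 3 3) * T 0 1 3 + A 1 2 * T 0 2 3 - A 0 2 * T 1 2 3 = 0
  three023 : - A 3 1 * T 0 1 2 + A 2 1 * T 0 1 3 + (A 0 0 + A 2 2 + A 3 3) * T 0 2 3 + A 0 1 * T 1 2 3 = 0
  three123 : A 3 0 * T 0 1 2 - A 2 0 * T 0 1 3 + A 1 0 * T 0 2 3 + (A 1 1 + A 2 2 + A 3 3) * T 1 2 3 = - (c * T 0 3 4)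
  heis : c * T 0 3 5 = 0

set_option linter.unusedSimpArgs false in
theorem HasBrackets.closedComp {e : Basis (Fin 5) ℝ L} {c : ℝ} {A : Matrix (Fin 4) (Fin 4) ℝ}
    (H : HasBrackets e c A) {ρ : (L × ℝ) [⋀^Fin 3]→ₗ[ℝ] ℝ} (hρ : ceD (L × ℝ) 2 ρ = 0) :
    ClosedComp c A (comp (prodBasis e) ρ) := by
  have hbi : ∀ i : Fin 5, prodBasis e i.castSucc = (e i, 0) := prodBasis_castSucc e
  have hb5 : prodBasis e 5 = (0, 1) := prodBasis_five e
  -- only these two properties of the basis matter, and its definition is costly to unfold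
  generalize prodBasis e = b at hbi hb5 ⊢
  have h1 : ∀ i j k : Fin 6, j < i → comp b ρ i j k = - comp b ρ j i k :=
    fun i j k _ => map_swap_left ρ _ _ _
  have h2 : ∀ i j k : Fin 6, k < j → comp b ρ i j k = - comp b ρ i k j :=
    fun i j k _ => map_swap_right ρ _ _ _
  have h3 : ∀ i k : Fin 6, comp b ρ i i k = 0 := fun i k => map_self_left ρ _ _
  have h4 : ∀ i k : Fin 6, comp b ρ i k k = 0 := fun i k => map_self_right ρ _ _
  have bracket : ∀ i j : Fin 5, ⁅b i.castSucc, b j.castSucc⁆ = ((⁅e i, e j⁆, 0) : L × ℝ) := by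
    intro i j
    rw [hbi, hbi]
    ext <;> simp
  have bracket5 : ∀ i : Fin 5, ⁅b i.castSucc, b 5⁆ = 0 := by
    intro i
    rw [hbi, hb5]
    ext <;> simp
  have ad : ∀ i : Fin 4, ⁅b i.castSucc.castSucc, b 4⁆ =
      ∑ m : Fin 4, A i m • b m.castSucc.castSucc := by
    intro i
    have : b 4 = b (4 : Fin 5).castSucc := rfl
    rw [this, bracket, H.ad i]
    simp only [hbi]
    ext <;> simp [Prod.fst_sum, Prod.snd_sum]
  have ρ_ad : ∀ (i : Fin 4) (j k : Fin 6), ρ ![⁅b i.castSucc.castSucc, b 4⁆, b j, b k] =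
      ∑ m : Fin 4, A i m * comp b ρ m.castSucc.castSucc j k := by
    intro i j k
    rw [ad, map_sum_smul_left]
    rfl
  have ρ_zero : ∀ {x y z : L × ℝ}, x = 0 → ρ ![x, y, z] = 0 :=
    fun hx => ρ.map_coord_zero (0 : Fin 3) hx
  have zero : ∀ {i j : Fin 5}, ⁅e i, e j⁆ = 0 → ⁅b i.castSucc, b j.castSucc⁆ = 0 :=
    fun h => by rw [bracket, h]; rfl
  have b12 : ∀ j k : Fin 6, ρ ![⁅b 1, b 2⁆, b j, b k] = c * comp b ρ 0 j k := by
    intro j k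
    have h12 : ⁅b 1, b 2⁆ = ∑ i : Fin 1, (fun _ => c) i • b 0 := by
      have h := bracket 1 2
      have h0 := hbi 0
      simp only [Fin.castSucc_one, Fin.castSucc_zero] at h h0
      rw [show b 2 = b (Fin.castSucc 2) from rfl, h, H.b23, h0]
      ext <;> simp
    rw [h12, map_sum_smul_left]
    simp [comp]
  have d : ∀ i j k l : Fin 6, - ρ ![⁅b i, b j⁆, b k, b l] + ρ ![⁅b i, b k⁆, b j, b l]
      - ρ ![⁅b i, b l⁆, b j, b k] - ρ ![⁅b j, b k⁆, b i, b l] + ρ ![⁅b j, b l⁆, b i, b k]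
      - ρ ![⁅b k, b l⁆, b i, b j] = 0 := by
    intro i j k l
    rw [← ceD_two_apply, hρ]
    rfl
  have z01 : ⁅b 0, b 1⁆ = 0 := zero H.b12
  have z02 : ⁅b 0, b 2⁆ = 0 := zero H.b13
  have z03 : ⁅b 0, b 3⁆ = 0 := zero H.b14
  have z13 : ⁅b 1, b 3⁆ = 0 := zero H.b24
  have z23 : ⁅b 2, b 3⁆ = 0 := zero H.b34
  have z05 : ⁅b 0, b 5⁆ = 0 := bracket5 0
  have z15 : ⁅b 1, b 5⁆ = 0 := bracket5 1
  have z25 : ⁅b 2, b 5⁆ = 0 := bracket5 2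
  have z35 : ⁅b 3, b 5⁆ = 0 := bracket5 3
  have z45 : ⁅b 4, b 5⁆ = 0 := bracket5 4
  have a0 : ∀ j k, ρ ![⁅b 0, b 4⁆, b j, b k] = _ := ρ_ad 0
  have a1 : ∀ j k, ρ ![⁅b 1, b 4⁆, b j, b k] = _ := ρ_ad 1
  have a2 : ∀ j k, ρ ![⁅b 2, b 4⁆, b j, b k] = _ := ρ_ad 2
  have a3 : ∀ j k, ρ ![⁅b 3, b 4⁆, b j, b k] = _ := ρ_ad 3
  constructor
  · have h := d 0 1 4 5
    simp only [z01, z02, z03, z13, z23, z05, z15, z25, z35, z45, ρ_zero rfl, b12, a0, a1, a2, a3,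
      Fin.sum_univ_four] at h
    simp [h1, h2, h3, h4] at h
    linear_combination h
  · have h := d 0 2 4 5
    simp only [z01, z02, z03, z13, z23, z05, z15, z25, z35, z45, ρ_zero rfl, b12, a0, a1, a2, a3,
      Fin.sum_univ_four] at h
    simp [h1, h2, h3, h4] at h
    linear_combination h
  · have h := d 0 3 4 5
    simp only [z01, z02, z03, z13, z23, z05, z15, z25, z35, z45, ρ_zero rfl, b12, a0, a1, a2, a3,
      Fin.sum_univ_four] at h
    simp [h1, h2, h3, h4] at h
    linear_combination h
  · have h := d 1 2 4 5
    simp only [z01, z02, z03, z13, z23, z05, z15, z25, z35, z45, ρ_zero rfl, b12, a0, a1, a2, a3,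
      Fin.sum_univ_four] at h
    simp [h1, h2, h3, h4] at h
    linear_combination h
  · have h := d 1 3 4 5
    simp only [z01, z02, z03, z13, z23, z05, z15, z25, z35, z45, ρ_zero rfl, b12, a0, a1, a2, a3,
      Fin.sum_univ_four] at h
    simp [h1, h2, h3, h4] at h
    linear_combination h
  · have h := d 2 3 4 5
    simp only [z01, z02, z03, z13, z23, z05, z15, z25, z35, z45, ρ_zero rfl, b12, a0, a1, a2, a3,
      Fin.sum_univ_four] at h
    simp [h1, h2, h3, h4] at h
    linear_combination h
  · have h := d 0 1 2 4
    simp only [z01, z02, z03, z13, z23, z05, z15, z25, z35, z45, ρ_zero rfl, b12, a0, a1, a2, a3,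
      Fin.sum_univ_four] at h
    simp [h1, h2, h3, h4] at h
    linear_combination -h
  · have h := d 0 1 3 4
    simp only [z01, z02, z03, z13, z23, z05, z15, z25, z35, z45, ρ_zero rfl, b12, a0, a1, a2, a3,
      Fin.sum_univ_four] at h
    simp [h1, h2, h3, h4] at h
    linear_combination -h
  · have h := d 0 2 3 4
    simp only [z01, z02, z03, z13, z23, z05, z15, z25, z35, z45, ρ_zero rfl, b12, a0, a1, a2, a3,
      Fin.sum_univ_four] at h
    simp [h1, h2, h3, h4] at h
    linear_combination -h
  · have h := d 1 2 3 4
    simp only [z01, z02, z03, z13, z23, z05, z15, z25, z35, z45, ρ_zero rfl, b12, a0, a1, a2, a3,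
      Fin.sum_univ_four] at h
    simp [h1, h2, h3, h4] at h
    linear_combination -h
  · have h := d 1 2 3 5
    simp only [z01, z02, z03, z13, z23, z05, z15, z25, z35, z45, ρ_zero rfl, b12, a0, a1, a2, a3,
      Fin.sum_univ_four] at h
    linear_combination -h
end Closed

/-! ### The table of Lie algebras -/

section Degenerate

/-- In the notation of `quartic_eq`: the two-form `ω` on `⟨e₁,…,e₄⟩` is degenerate (`pf`), and the
hook `x ⌟ ω` of the vector `x` corresponding to `ψ` vanishes (`hook0`, …, `hook3`). Then `λ(ρ)` is the
square `(β(x) + σ ∧ ω)²`. -/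
structure Degenerate (T : Fin 6 → Fin 6 → Fin 6 → ℝ) : Prop where
  pf : T 0 1 5 * T 2 3 5 - T 0 2 5 * T 1 3 5 + T 0 3 5 * T 1 2 5 = 0
  hook0 : T 0 2 3 * T 0 1 5 - T 0 1 3 * T 0 2 5 + T 0 1 2 * T 0 3 5 = 0
  hook1 : T 1 2 3 * T 0 1 5 - T 0 1 3 * T 1 2 5 + T 0 1 2 * T 1 3 5 = 0
  hook2 : T 1 2 3 * T 0 2 5 - T 0 2 3 * T 1 2 5 + T 0 1 2 * T 2 3 5 = 0
  hook3 : T 1 2 3 * T 0 3 5 - T 0 2 3 * T 1 3 5 + T 0 1 3 * T 2 3 5 = 0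

theorem Degenerate.quartic_nonneg {V : Type*} [AddCommGroup V] [Module ℝ V]
    {b : Basis (Fin 6) ℝ V} {ρ : V [⋀^Fin 3]→ₗ[ℝ] ℝ} (h : Degenerate (comp b ρ)) :
    0 ≤ quartic b ρ := by
  rw [quartic_eq, h.pf, h.hook0, h.hook1, h.hook2, h.hook3]
  simp only [mul_zero, zero_mul, sub_zero, add_zero]
  positivity

end Degenerate

section Cases

/-- The matrix `!![a, b; -b, a]` has no kernel if `b ≠ 0`. This is how the complex eigenvalues of the
table enter. -/
theorem eq_zero_of_rotation {a b x y : ℝ} (hb : b ≠ 0) (h1 : a * x + b * y = 0)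
    (h2 : -(b * x) + a * y = 0) : x = 0 ∧ y = 0 := by
  have h : a ^ 2 + b ^ 2 ≠ 0 := by positivity
  constructor
  · refine (mul_eq_zero.1 (?_ : (a ^ 2 + b ^ 2) * x = 0)).resolve_left h
    linear_combination a * h1 - b * h2
  · refine (mul_eq_zero.1 (?_ : (a ^ 2 + b ^ 2) * y = 0)).resolve_left h
    linear_combination b * h1 + a * h2

/-- The action of `A` on the line `Λ⁴⟨e₁,…,e₄⟩*` is by its trace, and it annihilates `ω ∧ ω`. -/
theorem ClosedComp.trace_mul_pf {A : Matrix (Fin 4) (Fin 4) ℝ} {T : Fin 6 → Fin 6 → Fin 6 → ℝ}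
    (h : ClosedComp 0 A T) : (A 0 0 + A 1 1 + A 2 2 + A 3 3) *
      (T 0 1 5 * T 2 3 5 - T 0 2 5 * T 1 3 5 + T 0 3 5 * T 1 2 5) = 0 := by
  linear_combination T 2 3 5 * h.two01 + T 0 1 5 * h.two23 - T 1 3 5 * h.two02
    - T 0 2 5 * h.two13 + T 1 2 5 * h.two03 + T 0 3 5 * h.two12

/-- The criterion for the algebras with ideal `𝔥₃ ⊕ ℝ`, where `e₁ ⌟ ω` always vanishes. -/
theorem Degenerate.of_vanish {T : Fin 6 → Fin 6 → Fin 6 → ℝ} (h01 : T 0 1 5 = 0) (h02 : T 0 2 5 = 0)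
    (h03 : T 0 3 5 = 0) (h013 : T 0 1 3 = 0) (h023 : T 0 2 3 = 0)
    (h1 : T 0 1 2 * T 1 3 5 = 0) (h2 : T 0 1 2 * T 2 3 5 = 0) : Degenerate T := by
  constructor <;> simp [*]


theorem Degenerate.of_three_eq_zero {T : Fin 6 → Fin 6 → Fin 6 → ℝ} (p012 : T 0 1 2 = 0)
    (p013 : T 0 1 3 = 0) (p023 : T 0 2 3 = 0) (p123 : T 1 2 3 = 0)
    (pf : T 0 1 5 * T 2 3 5 - T 0 2 5 * T 1 3 5 + T 0 3 5 * T 1 2 5 = 0) : Degenerate T := by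
  constructor <;> simp [*]

/-- For a diagonal `A` each non-zero component of `ω` or `ψ` yields a vanishing sum of eigenvalues, and
the hypothesis excludes every pair of components that contributes to `Pf(ω)` (by `hww`) or to
`x ⌟ ω` (by `hpw`). -/
theorem ClosedComp.degenerate_diagonal {μ : Fin 4 → ℝ} {T : Fin 6 → Fin 6 → Fin 6 → ℝ}
    (h : ∀ i j k l : Fin 4, [i, j, k, l].Nodup → μ i + μ j = 0 →
      μ k + μ l ≠ 0 ∧ μ k + μ l ≠ μ i)
    (hT : ClosedComp 0 (Matrix.diagonal μ) T) : Degenerate T := by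
  obtain ⟨h01, h02, h03, h12, h13, h23, h012, h013, h023, h123, -⟩ := hT
  simp only [Matrix.diagonal_apply, Fin.reduceEq, ↓reduceIte, zero_mul, add_zero, zero_add,
    sub_zero, neg_zero] at h01 h02 h03 h12 h13 h23 h012 h013 h023 h123
  have hww : ∀ i j k l : Fin 4, [i, j, k, l].Nodup → ∀ {w w' : ℝ}, (μ i + μ j) * w = 0 →
      (μ k + μ l) * w' = 0 → w * w' = 0 := by
    intro i j k l hn w w' hw hw'
    rcases mul_eq_zero.1 hw with h1 | h1
    · simp [(mul_eq_zero.1 hw').resolve_left (h i j k l hn h1).1]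
    · simp [h1]
  have hpw : ∀ i j k l : Fin 4, [i, j, k, l].Nodup → ∀ {p w : ℝ}, (μ i + μ j) * w = 0 →
      (μ j + μ k + μ l) * p = 0 → p * w = 0 := by
    intro i j k l hn p w hw hp
    rcases mul_eq_zero.1 hw with h1 | h1
    · have h2 : μ j + μ k + μ l ≠ 0 := fun h2 => (h i j k l hn h1).2 (by linarith)
      simp [(mul_eq_zero.1 hp).resolve_left h2]
    · simp [h1]
  constructor
  · rw [hww 0 1 2 3 (by decide) h01 h23, hww 0 2 1 3 (by decide) h02 h13,
      hww 0 3 1 2 (by decide) h03 h12]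
    simp
  · rw [hpw 1 0 2 3 (by decide) (w := T 0 1 5) (p := T 0 2 3)
        (by linear_combination h01) (by linear_combination h023),
      hpw 2 0 1 3 (by decide) (w := T 0 2 5) (p := T 0 1 3)
        (by linear_combination h02) (by linear_combination h013),
      hpw 3 0 1 2 (by decide) (w := T 0 3 5) (p := T 0 1 2)
        (by linear_combination h03) (by linear_combination h012)]
    simp
  · rw [hpw 0 1 2 3 (by decide) (w := T 0 1 5) (p := T 1 2 3)
        (by linear_combination h01) (by linear_combination h123),
      hpw 2 1 0 3 (by decide) (w := T 1 2 5) (p := T 0 1 3)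
        (by linear_combination h12) (by linear_combination h013),
      hpw 3 1 0 2 (by decide) (w := T 1 3 5) (p := T 0 1 2)
        (by linear_combination h13) (by linear_combination h012)]
    simp
  · rw [hpw 0 2 1 3 (by decide) (w := T 0 2 5) (p := T 1 2 3)
        (by linear_combination h02) (by linear_combination h123),
      hpw 1 2 0 3 (by decide) (w := T 1 2 5) (p := T 0 2 3)
        (by linear_combination h12) (by linear_combination h023),
      hpw 3 2 0 1 (by decide) (w := T 2 3 5) (p := T 0 1 2)
        (by linear_combination h23) (by linear_combination h012)]
    simp
  · rw [hpw 0 3 1 2 (by decide) (w := T 0 3 5) (p := T 1 2 3)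
        (by linear_combination h03) (by linear_combination h123),
      hpw 1 3 0 2 (by decide) (w := T 1 3 5) (p := T 0 2 3)
        (by linear_combination h13) (by linear_combination h023),
      hpw 2 3 0 1 (by decide) (w := T 2 3 5) (p := T 0 1 3)
        (by linear_combination h23) (by linear_combination h013)]
    simp

set_option maxHeartbeats 4000000 in
theorem MarkedR4.degenerate {A : Matrix (Fin 4) (Fin 4) ℝ} {T : Fin 6 → Fin 6 → Fin 6 → ℝ}
    (hA : MarkedR4 A) (hT : ClosedComp 0 A T) : Degenerate T := by
  have tr := hT.trace_mul_pf
  obtain ⟨h01, h02, h03, h12, h13, h23, h012, h013, h023, h123, -⟩ := id hT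
  cases hA
  case A7 μ _ _ h => exact hT.degenerate_diagonal h
  all_goals clear hT
  case A8 γ h0 h =>
    have pf := (mul_eq_zero.1 tr).resolve_left (by simp; grind)
    clear tr
    simp at h01 h02 h03 h12 h13 h23 h012 h013 h023 h123
    have p012 : T 0 1 2 = 0 := by grind
    have p013 : T 0 1 3 = 0 := by grind
    have p023 : T 0 2 3 = 0 := by grind
    have p123 : T 1 2 3 = 0 := by grind
    exact .of_three_eq_zero p012 p013 p023 p123 pf
  case A9 β γ hβ hγ h1 h2 h3 h4 =>
    clear tr
    simp at h01 h02 h03 h12 h13 h23 h012 h013 h023 h123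
    have w01 : T 0 1 5 = 0 := by grind
    have w02 : T 0 2 5 = 0 := by grind
    have w03 : T 0 3 5 = 0 := by grind
    have p023 : T 0 2 3 = 0 := by grind
    constructor <;> grind
  case A10 =>
    clear tr
    simp at h01 h02 h03 h12 h13 h23 h012 h013 h023 h123
    have w01 : T 0 1 5 = 0 := by grind
    have w02 : T 0 2 5 = 0 := by grind
    have w03 : T 0 3 5 = 0 := by grind
    have p013 : T 0 1 3 = 0 := by grind
    have p023 : T 0 2 3 = 0 := by grind
    constructor <;> grind
  case A11 γ h0 =>
    clear tr
    simp at h01 h02 h03 h12 h13 h23 h012 h013 h023 h123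
    have w01 : T 0 1 5 = 0 := by grind
    have w02 : T 0 2 5 = 0 := by grind
    have w12 : T 1 2 5 = 0 := by grind
    have w03 : T 0 3 5 = 0 := by grind
    have w13 : T 1 3 5 = 0 := by grind
    have p012 : T 0 1 2 = 0 := by grind
    have p013 : T 0 1 3 = 0 := by grind
    have p023 : T 0 2 3 = 0 := by grind
    constructor <;> grind
  case A12 =>
    have pf := (mul_eq_zero.1 tr).resolve_left (by simp; norm_num)
    clear tr
    simp at h01 h02 h03 h12 h13 h23 h012 h013 h023 h123
    have p012 : T 0 1 2 = 0 := by grind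
    have p013 : T 0 1 3 = 0 := by grind
    have p023 : T 0 2 3 = 0 := by grind
    have p123 : T 1 2 3 = 0 := by grind
    exact .of_three_eq_zero p012 p013 p023 p123 pf
  case A13 α β γ hα hγ h =>
    clear tr
    simp at h01 h02 h03 h12 h13 h23 h012 h013 h023 h123
    obtain ⟨w02, w03⟩ := eq_zero_of_rotation (a := 1 + β) (b := -γ) (x := T 0 2 5) (y := T 0 3 5) (neg_ne_zero.2 hγ)
      (by linear_combination h02) (by linear_combination h03)
    obtain ⟨w12, w13⟩ := eq_zero_of_rotation (a := α + β) (b := -γ) (x := T 1 2 5) (y := T 1 3 5) (neg_ne_zero.2 hγ)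
      (by linear_combination h12) (by linear_combination h13)
    obtain ⟨p012, p013⟩ := eq_zero_of_rotation (a := 1 + α + β) (b := -γ) (x := T 0 1 2) (y := T 0 1 3) (neg_ne_zero.2 hγ)
      (by linear_combination h012) (by linear_combination h013)
    constructor <;> grind
  case A14 α h =>
    have pf := (mul_eq_zero.1 tr).resolve_left (by simp; grind)
    clear tr
    simp at h01 h02 h03 h12 h13 h23 h012 h013 h023 h123
    obtain ⟨p012, p013⟩ := eq_zero_of_rotation (a := α) (b := -1) (x := T 0 1 2) (y := T 0 1 3) (neg_ne_zero.2 one_ne_zero)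
      (by linear_combination h012) (by linear_combination h013)
    have p023 : T 0 2 3 = 0 := by grind
    have p123 : T 1 2 3 = 0 := by grind
    exact .of_three_eq_zero p012 p013 p023 p123 pf
  case A15 α h =>
    clear tr
    simp at h01 h02 h03 h12 h13 h23 h012 h013 h023 h123
    have w01 : T 0 1 5 = 0 := by grind
    have w02 : T 0 2 5 = 0 := by grind
    have w03 : T 0 3 5 = 0 := by grind
    have w12 : T 1 2 5 = 0 := by grind
    have w13 : T 1 3 5 = 0 := by grind
    have p012 : T 0 1 2 = 0 := by grind
    have p023 : T 0 2 3 = 0 := by grind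
    constructor <;> grind
  case A16 α β h =>
    clear tr
    simp at h01 h02 h03 h12 h13 h23 h012 h013 h023 h123
    have w01 : T 0 1 5 = 0 := by grind
    obtain ⟨w02, w03⟩ := eq_zero_of_rotation (a := 1 + α) (b := -β) (x := T 0 2 5) (y := T 0 3 5) (neg_ne_zero.2 h)
      (by linear_combination h02) (by linear_combination h03)
    obtain ⟨w12, w13⟩ := eq_zero_of_rotation (a := 1 + α) (b := -β) (x := T 1 2 5) (y := T 1 3 5) (neg_ne_zero.2 h)
      (by linear_combination h12 - w02) (by linear_combination h13 - w03)
    obtain ⟨p012, p013⟩ := eq_zero_of_rotation (a := 2 + α) (b := -β) (x := T 0 1 2) (y := T 0 1 3) (neg_ne_zero.2 h)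
      (by linear_combination h012) (by linear_combination h013)
    constructor <;> grind
  case A17 α β γ hγ h1 h2 =>
    simp at h01 h02 h03 h12 h13 h23 h012 h013 h023 h123 tr
    obtain ⟨p012, p013⟩ := eq_zero_of_rotation (a := 2 * α + β) (b := -γ) (x := T 0 1 2) (y := T 0 1 3) (neg_ne_zero.2 hγ)
      (by linear_combination h012) (by linear_combination h013)
    obtain ⟨p023, p123⟩ := eq_zero_of_rotation (a := α + 2 * β) (b := -1) (x := T 0 2 3) (y := T 1 2 3) (neg_ne_zero.2 one_ne_zero)
      (by linear_combination h023) (by linear_combination h123)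
    refine .of_three_eq_zero p012 p013 p023 p123 ?_
    by_cases hβ : β = -α
    · -- the mixed components of `ω` have the weights `± i (1 ± γ)`
      have hγ' : 1 - γ ^ 2 ≠ 0 := by grind
      grind
    · grind
  case A18 α h =>
    have pf := (mul_eq_zero.1 tr).resolve_left (by simp; grind)
    clear tr
    simp at h01 h02 h03 h12 h13 h23 h012 h013 h023 h123
    obtain ⟨p012, p013⟩ := eq_zero_of_rotation (a := 3 * α) (b := -1) (x := T 0 1 2) (y := T 0 1 3) (neg_ne_zero.2 one_ne_zero)
      (by linear_combination h012) (by linear_combination h013)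
    obtain ⟨p023, p123⟩ := eq_zero_of_rotation (a := 3 * α) (b := -1) (x := T 0 2 3) (y := T 1 2 3) (neg_ne_zero.2 one_ne_zero)
      (by linear_combination h023 + p012) (by linear_combination h123 + p013)
    exact .of_three_eq_zero p012 p013 p023 p123 pf

set_option maxHeartbeats 4000000 in
theorem MarkedH3R.degenerate {A : Matrix (Fin 4) (Fin 4) ℝ} {T : Fin 6 → Fin 6 → Fin 6 → ℝ}
    (hA : MarkedH3R A) (hT : ClosedComp 1 A T) : Degenerate T := by
  obtain ⟨h01, h02, -, -, h13, h23, h012, h013, h023, -, h⟩ := hT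
  have h03 : T 0 3 5 = 0 := by simpa using h
  clear h
  cases hA
  case A19 α β hβ h1 h2 h3 h4 =>
    simp [h03] at h01 h02 h13 h23 h012 h013 h023
    have w01 : T 0 1 5 = 0 := by grind
    have w02 : T 0 2 5 = 0 := by grind
    have p013 : T 0 1 3 = 0 := by grind
    have p023 : T 0 2 3 = 0 := by grind
    exact .of_vanish w01 w02 h03 p013 p023 (by grind) (by grind)
  case A20 α h1 h2 =>
    simp [h03] at h01 h02 h13 h23 h012 h013 h023
    have w01 : T 0 1 5 = 0 := by grind
    have w02 : T 0 2 5 = 0 := by grind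
    have p013 : T 0 1 3 = 0 := by grind
    have p023 : T 0 2 3 = 0 := by grind
    exact .of_vanish w01 w02 h03 p013 p023 (by grind) (by grind)
  case A21 =>
    simp [h03] at h01 h02 h13 h23 h012 h013 h023
    have w01 : T 0 1 5 = 0 := by grind
    have w02 : T 0 2 5 = 0 := by grind
    have p013 : T 0 1 3 = 0 := by grind
    have p023 : T 0 2 3 = 0 := by grind
    exact .of_vanish w01 w02 h03 p013 p023 (by grind) (by grind)
  case A23 β hβ h =>
    simp [h03] at h01 h02 h13 h23 h012 h013 h023
    have w01 : T 0 1 5 = 0 := by grind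
    have w02 : T 0 2 5 = 0 := by grind
    have p013 : T 0 1 3 = 0 := by grind
    have p023 : T 0 2 3 = 0 := by grind
    exact .of_vanish w01 w02 h03 p013 p023 (by grind) (by grind)
  case A24 ε hε =>
    simp [h03] at h01 h02 h13 h23 h012 h013 h023
    have w01 : T 0 1 5 = 0 := by grind
    have w02 : T 0 2 5 = 0 := by grind
    have p013 : T 0 1 3 = 0 := by grind
    have p023 : T 0 2 3 = 0 := by grind
    exact .of_vanish w01 w02 h03 p013 p023 (by grind) (by grind)
  case A25 β α hβ =>
    simp [h03] at h01 h02 h13 h23 h012 h013 h023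
    obtain ⟨w01, w02⟩ := eq_zero_of_rotation one_ne_zero (a := 3 * α) (x := T 0 1 5) (y := T 0 2 5)
      (by linear_combination h01) (by linear_combination h02)
    obtain ⟨w13, w23⟩ := eq_zero_of_rotation one_ne_zero (a := α + β) (x := T 1 3 5) (y := T 2 3 5)
      (by linear_combination h13) (by linear_combination h23)
    obtain ⟨p013, p023⟩ := eq_zero_of_rotation one_ne_zero (a := 3 * α + β) (x := T 0 1 3) (y := T 0 2 3)
      (by linear_combination h013) (by linear_combination h023)
    exact .of_vanish w01 w02 h03 p013 p023 (by simp [w13]) (by simp [w23])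
  case A26 α ε hε =>
    simp [h03] at h01 h02 h13 h23 h012 h013 h023
    obtain ⟨w01, w02⟩ := eq_zero_of_rotation one_ne_zero (a := 3 * α) (x := T 0 1 5) (y := T 0 2 5)
      (by linear_combination h01) (by linear_combination h02)
    obtain ⟨w13, w23⟩ := eq_zero_of_rotation one_ne_zero (a := 3 * α) (x := T 1 3 5) (y := T 2 3 5)
      (by linear_combination h13 + ε * w01) (by linear_combination h23 + ε * w02)
    obtain ⟨p013, p023⟩ := eq_zero_of_rotation one_ne_zero (a := 5 * α) (x := T 0 1 3) (y := T 0 2 3)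
      (by linear_combination h013) (by linear_combination h023)
    exact .of_vanish w01 w02 h03 p013 p023 (by simp [w13]) (by simp [w23])
  case A27 =>
    simp [h03] at h01 h02 h13 h23 h012 h013 h023
    have w01 : T 0 1 5 = 0 := by grind
    have w02 : T 0 2 5 = 0 := by grind
    have p013 : T 0 1 3 = 0 := by grind
    have p023 : T 0 2 3 = 0 := by grind
    exact .of_vanish w01 w02 h03 p013 p023 (by grind) (by grind)
  case A28 α h1 h2 h3 h4 =>
    simp [h03] at h01 h02 h13 h23 h012 h013 h023
    have w01 : T 0 1 5 = 0 := by grind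
    have w02 : T 0 2 5 = 0 := by grind
    have p013 : T 0 1 3 = 0 := by grind
    have p023 : T 0 2 3 = 0 := by grind
    exact .of_vanish w01 w02 h03 p013 p023 (by grind) (by grind)
  case A29 =>
    simp [h03] at h01 h02 h13 h23 h012 h013 h023
    have w01 : T 0 1 5 = 0 := by grind
    have w02 : T 0 2 5 = 0 := by grind
    have p013 : T 0 1 3 = 0 := by grind
    have p023 : T 0 2 3 = 0 := by grind
    exact .of_vanish w01 w02 h03 p013 p023 (by grind) (by grind)

end Cases

/-! ### Abelian nilradical and vanishing third cohomology -/

section AbelianNilradical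

variable {L : Type*} [LieRing L] [LieAlgebra ℝ L]

/-- If the nilradical is `ℝ⁴`, a basis of it completed by any further vector puts the brackets of `L`
in the form of an extension of `ℝ⁴` by a matrix `A`. -/
theorem NilradicalIsR4.exists_basis (hdim : finrank ℝ L = 5) (h : NilradicalIsR4 L) :
    ∃ (e : Basis (Fin 5) ℝ L) (A : Matrix (Fin 4) (Fin 4) ℝ),
      (∀ i j : Fin 4, ⁅e i.castSucc, e j.castSucc⁆ = 0) ∧
      ∀ i : Fin 4, ⁅e i.castSucc, e 4⁆ = ∑ j : Fin 4, A i j • e j.castSucc := by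
  obtain ⟨hab, hN⟩ := h
  have : Module.Finite ℝ L := Module.finite_of_finrank_eq_succ hdim
  let N : LieIdeal ℝ L := nilradical L
  let bN : Basis (Fin 4) ℝ N := finBasisOfFinrankEq ℝ N hN
  obtain ⟨y, hy⟩ : ∃ y : L, y ∉ N := by
    by_contra! hall
    have htop : N.toSubmodule = ⊤ := eq_top_iff.2 fun y _ => hall y
    have h4 : finrank ℝ N.toSubmodule = 4 := hN
    rw [htop, finrank_top, hdim] at h4
    omega
  have hli : LinearIndependent ℝ (Fin.snoc (fun i => (bN i : L)) y : Fin 5 → L) := by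
    rw [linearIndependent_finSnoc]
    refine ⟨bN.linearIndependent.map' N.toSubmodule.subtype (Submodule.ker_subtype _),
      fun hmem => hy ?_⟩
    refine (Submodule.span_le (p := N.toSubmodule)).2 ?_ hmem
    rintro _ ⟨i, rfl⟩
    exact (bN i).2
  let e : Basis (Fin 5) ℝ L := basisOfLinearIndependentOfCardEqFinrank hli (by simp [hdim])
  have he : ∀ i : Fin 4, e i.castSucc = bN i := fun i => by simp [e]
  have he4 : e 4 = y := by
    change e (Fin.last 4) = y
    simp only [e, coe_basisOfLinearIndependentOfCardEqFinrank, Fin.snoc_last]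
  refine ⟨e, fun i j => bN.repr ⟨⁅(bN i : L), y⁆, lie_mem_left ℝ L N _ _ (bN i).2⟩ j,
    fun i j => ?_, fun i => ?_⟩
  · rw [he, he]
    exact congrArg Subtype.val (hab.trivial (bN i) (bN j))
  · rw [he, he4]
    have h := congrArg Subtype.val
      (bN.sum_repr ⟨⁅(bN i : L), y⁆, lie_mem_left ℝ L N _ _ (bN i).2⟩)
    refine h.symm.trans ?_
    simp only [he]
    push_cast
    rfl

/-- If `h³(L) = 0`, every closed three-form is exact. -/
theorem exists_ceD_one_eq (hdim : finrank ℝ L = 5) (h : h3 L = 0) {τ : L [⋀^Fin 3]→ₗ[ℝ] ℝ}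
    (hτ : ceD L 2 τ = 0) : ∃ η : L [⋀^Fin 2]→ₗ[ℝ] ℝ, ceD L 1 η = τ := by
  have : Module.Finite ℝ L := Module.finite_of_finrank_eq_succ hdim
  have : Module.Finite ℝ (L [⋀^Fin 3]→ₗ[ℝ] ℝ) :=
    Module.Finite.equiv
      (exteriorPower.alternatingMapLinearEquiv (R := ℝ) (M := L) (N := ℝ) (n := 3)).symm
  have hbot : (cocycles L 2).map (coboundaries L 1).mkQ = ⊥ := Submodule.finrank_eq_zero.1 h
  have hmem : (coboundaries L 1).mkQ τ ∈ (cocycles L 2).map (coboundaries L 1).mkQ :=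
    Submodule.mem_map_of_mem hτ
  rw [hbot, Submodule.mem_bot, Submodule.mkQ_apply, Submodule.Quotient.mk_eq_zero] at hmem
  exact hmem

variable {e : Basis (Fin 5) ℝ L} {A : Matrix (Fin 4) (Fin 4) ℝ}

/-- The skew-symmetric matrix of the restriction of a two-form to `⟨e₁,…,e₄⟩`. -/
def gram (e : Basis (Fin 5) ℝ L) (η : L [⋀^Fin 2]→ₗ[ℝ] ℝ) : Matrix (Fin 4) (Fin 4) ℝ :=
  Matrix.of fun i j => η ![e i.castSucc, e j.castSucc]

theorem map_swap_two {V : Type*} [AddCommGroup V] [Module ℝ V] (η : V [⋀^Fin 2]→ₗ[ℝ] ℝ) (x y : V) :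
    η ![y, x] = - η ![x, y] := by
  rw [← η.map_swap ![x, y] (show (0 : Fin 2) ≠ 1 by decide)]
  congr 1; ext i; fin_cases i <;> simp

theorem gram_transpose (η : L [⋀^Fin 2]→ₗ[ℝ] ℝ) : (gram e η).transpose = - gram e η := by
  ext i j
  exact map_swap_two _ _ _

/-- Restricted to `⟨e₁,…,e₄⟩`, the form `e₅ ⌟ dη` is the derivation action of `A` on `η`. -/
theorem ceD_one_basis (hab : ∀ i j : Fin 4, ⁅e i.castSucc, e j.castSucc⁆ = 0)
    (had : ∀ i : Fin 4, ⁅e i.castSucc, e 4⁆ = ∑ j : Fin 4, A i j • e j.castSucc)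
    (η : L [⋀^Fin 2]→ₗ[ℝ] ℝ) (i j : Fin 4) :
    ceD L 1 η ![e i.castSucc, e j.castSucc, e 4] =
      (A * gram e η + gram e η * A.transpose) i j := by
  have key : ∀ i j, η ![⁅e i.castSucc, e 4⁆, e j.castSucc] = (A * gram e η) i j := by
    intro i j
    let ev : L →ₗ[ℝ] ℝ :=
      { toFun := fun x => η.curryLeft x ![e j.castSucc]
        map_add' := fun x x' => by rw [map_add]; rfl
        map_smul' := fun c x => by rw [map_smul]; rfl }
    change ev _ = ∑ m, A i m * ev (e m.castSucc)
    simp only [had, map_sum, map_smul, smul_eq_mul]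
  have hT : (gram e η * A.transpose) i j = - (A * gram e η) j i := by
    rw [← Matrix.transpose_apply (A * gram e η), Matrix.transpose_mul, gram_transpose]
    simp
  rw [ceD_one_apply, hab, key, key, Matrix.add_apply, hT, η.map_coord_zero (0 : Fin 2) rfl]
  ring

/-- The three-form `eⁱ ∧ eʲ ∧ e⁵`, as a determinant of coordinates. -/
def coordThree (e : Basis (Fin 5) ℝ L) (i j : Fin 4) : L [⋀^Fin 3]→ₗ[ℝ] ℝ :=
  Matrix.detRowAlternating.compLinearMap
    (LinearMap.pi ![e.coord i.castSucc, e.coord j.castSucc, e.coord 4])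

theorem coordThree_apply (i j : Fin 4) (x y z : L) : coordThree e i j ![x, y, z] =
    Matrix.det !![e.repr x i.castSucc, e.repr x j.castSucc, e.repr x 4;
      e.repr y i.castSucc, e.repr y j.castSucc, e.repr y 4;
      e.repr z i.castSucc, e.repr z j.castSucc, e.repr z 4] := by
  change Matrix.det (_ : Matrix (Fin 3) (Fin 3) ℝ) = _
  congr 1
  ext a b
  fin_cases a <;> fin_cases b <;> rfl

theorem repr_bracket (hab : ∀ i j : Fin 4, ⁅e i.castSucc, e j.castSucc⁆ = 0)
    (had : ∀ i : Fin 4, ⁅e i.castSucc, e 4⁆ = ∑ j : Fin 4, A i j • e j.castSucc) (x y : L) :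
    e.repr ⁅x, y⁆ 4 = 0 ∧ ∀ i : Fin 4, e.repr ⁅x, y⁆ i.castSucc =
      (∑ m : Fin 4, e.repr x m.castSucc * A m i) * e.repr y 4 -
      (∑ m : Fin 4, e.repr y m.castSucc * A m i) * e.repr x 4 := by
  have hxy : ⁅x, y⁆ = ∑ i : Fin 4, ((∑ m : Fin 4, e.repr x m.castSucc * A m i) * e.repr y 4 -
      (∑ m : Fin 4, e.repr y m.castSucc * A m i) * e.repr x 4) • e i.castSucc := by
    have h4 : ∀ x : L, x = ∑ m : Fin 4, e.repr x m.castSucc • e m.castSucc + e.repr x 4 • e 4 := by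
      intro x
      conv_lhs => rw [← e.sum_repr x, Fin.sum_univ_castSucc]
      rfl
    have had' : ∀ x : L, ⁅∑ m : Fin 4, e.repr x m.castSucc • e m.castSucc, e 4⁆ =
        ∑ i : Fin 4, (∑ m : Fin 4, e.repr x m.castSucc * A m i) • e i.castSucc := by
      intro x
      simp only [sum_lie, smul_lie, had, Finset.smul_sum, smul_smul, Finset.sum_smul]
      exact Finset.sum_comm
    have hab' : ⁅∑ m : Fin 4, e.repr x m.castSucc • e m.castSucc,
        ∑ m : Fin 4, e.repr y m.castSucc • e m.castSucc⁆ = 0 := by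
      simp only [sum_lie, lie_sum, smul_lie, lie_smul, hab, smul_zero, Finset.sum_const_zero]
    conv_lhs => rw [h4 x, h4 y]
    rw [add_lie, lie_add, lie_add, hab', lie_smul, had', smul_lie, smul_lie,
      lie_smul, lie_self, ← lie_skew, had']
    simp only [sub_smul, Finset.sum_sub_distrib, Finset.smul_sum, smul_smul, smul_neg, smul_zero,
      add_zero, zero_add, mul_comm (e.repr x 4), mul_comm (e.repr y 4)]
    exact (sub_eq_add_neg _ _).symm
  have hne : ∀ m : Fin 4, m.castSucc ≠ (4 : Fin 5) := fun m => (Fin.castSucc_lt_last m).ne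
  constructor
  · rw [hxy]
    simp [hne]
  · intro i
    conv_lhs => rw [hxy]
    simp [Finsupp.single_apply]

theorem ceD_coordThree (hab : ∀ i j : Fin 4, ⁅e i.castSucc, e j.castSucc⁆ = 0)
    (had : ∀ i : Fin 4, ⁅e i.castSucc, e 4⁆ = ∑ j : Fin 4, A i j • e j.castSucc) (i j : Fin 4) :
    ceD L 2 (coordThree e i j) = 0 := by
  funext x
  have hx : x = ![x 0, x 1, x 2, x 3] := by
    ext k
    fin_cases k <;> rfl
  have h4 := fun x y => (repr_bracket hab had x y).1
  have hi := fun x y => (repr_bracket hab had x y).2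
  rw [hx, ceD_two_apply]
  simp only [coordThree_apply, Matrix.det_fin_three, Matrix.of_apply, Matrix.cons_val', Matrix.cons_val, h4, hi]
  simp only [Pi.zero_apply]
  ring

/-- Every three-form divisible by `e⁵` is closed. -/
theorem exists_closed (hab : ∀ i j : Fin 4, ⁅e i.castSucc, e j.castSucc⁆ = 0)
    (had : ∀ i : Fin 4, ⁅e i.castSucc, e 4⁆ = ∑ j : Fin 4, A i j • e j.castSucc)
    {M : Matrix (Fin 4) (Fin 4) ℝ} (hM : M.transpose = - M) :
    ∃ τ : L [⋀^Fin 3]→ₗ[ℝ] ℝ, ceD L 2 τ = 0 ∧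
      ∀ i j : Fin 4, τ ![e i.castSucc, e j.castSucc, e 4] = M i j := by
  refine ⟨∑ i, ∑ j, (M i j / 2) • coordThree e i j, ?_, fun k l => ?_⟩
  · simp only [map_sum, map_smul, ceD_coordThree hab had, smul_zero, Finset.sum_const_zero]
  · have hMkl : M l k = - M k l := congrFun (congrFun hM k) l
    have hne : ∀ m : Fin 4, m.castSucc ≠ (4 : Fin 5) := fun m => (Fin.castSucc_lt_last m).ne
    let ev : (L [⋀^Fin 3]→ₗ[ℝ] ℝ) →ₗ[ℝ] ℝ :=
      { toFun := fun τ => τ ![e k.castSucc, e l.castSucc, e 4]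
        map_add' := fun _ _ => rfl
        map_smul' := fun _ _ => rfl }
    have hev : ∀ i j, ev (coordThree e i j) =
        (if k = i then 1 else 0) * (if l = j then 1 else 0) -
          (if l = i then 1 else 0) * (if k = j then 1 else 0) := by
      intro i j
      change coordThree e i j ![e k.castSucc, e l.castSucc, e 4] = _
      simp [coordThree_apply, Matrix.det_fin_three, Finsupp.single_apply, hne, (hne _).symm]
      split_ifs <;> simp
    change ev (∑ i, ∑ j, (M i j / 2) • coordThree e i j) = M k l
    simp only [map_sum, map_smul, hev, smul_eq_mul, mul_sub, Finset.sum_sub_distrib]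
    simp [hMkl]
    ring

/-- If `M ↦ A M + M Aᵀ` is surjective on skew-symmetric matrices, then it is injective. -/
theorem skew_eq_zero {A : Matrix (Fin 4) (Fin 4) ℝ}
    (hsurj : ∀ M : Matrix (Fin 4) (Fin 4) ℝ, M.transpose = - M →
      ∃ H : Matrix (Fin 4) (Fin 4) ℝ, H.transpose = - H ∧ A * H + H * A.transpose = M)
    {W : Matrix (Fin 4) (Fin 4) ℝ} (hW : W.transpose = - W) (h : A * W + W * A.transpose = 0) :
    W = 0 := by
  let S : Submodule ℝ (Matrix (Fin 4) (Fin 4) ℝ) :=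
    { carrier := {M | M.transpose = - M}
      add_mem' := fun {M M'} hM hM' => by
        change (M + M').transpose = -(M + M')
        rw [Matrix.transpose_add, hM, hM', neg_add]
      zero_mem' := by simp
      smul_mem' := fun c M hM => by
        change (c • M).transpose = -(c • M)
        rw [Matrix.transpose_smul, hM, smul_neg] }
  let F : Matrix (Fin 4) (Fin 4) ℝ →ₗ[ℝ] Matrix (Fin 4) (Fin 4) ℝ :=
    LinearMap.mulLeft ℝ A + LinearMap.mulRight ℝ A.transpose
  have hF : ∀ M ∈ S, F M ∈ S := by
    intro M hM
    have hM : M.transpose = - M := hM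
    change (A * M + M * A.transpose).transpose = -(A * M + M * A.transpose)
    rw [Matrix.transpose_add, Matrix.transpose_mul, Matrix.transpose_mul, hM,
      Matrix.transpose_transpose]
    simp [add_comm]
  have hs : Function.Surjective (F.restrict hF) := by
    rintro ⟨M, hM⟩
    obtain ⟨H, hH, hHM⟩ := hsurj M hM
    exact ⟨⟨H, hH⟩, Subtype.ext hHM⟩
  have hi := LinearMap.injective_iff_surjective.2 hs
  have h0 : (⟨W, hW⟩ : S) = 0 := hi (by rw [map_zero]; exact Subtype.ext h)
  exact congrArg Subtype.val h0

end AbelianNilradical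

/-- A form in `Λ³` divisible by `e⁵` has `λ = 0`, and the hypotheses force this shape: `ψ` is exact, so
it vanishes on the abelian ideal, and `ω` restricted to the ideal is annihilated by `A`, whose action
is invertible. -/
theorem lambdaZero_of_h3_eq_zero {L : Type*} [LieRing L] [LieAlgebra ℝ L]
    (hdim : finrank ℝ L = 5) {ρ : (L × ℝ) [⋀^Fin 3]→ₗ[ℝ] ℝ} (hρ : ceD (L × ℝ) 2 ρ = 0)
    (hN : NilradicalIsR4 L) (h3 : h3 L = 0) : LambdaZero ρ := by
  obtain ⟨e, A, hab, had⟩ := hN.exists_basis hdim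
  have bracket : ∀ x y : L, ⁅((x, 0) : L × ℝ), ((y, 0) : L × ℝ)⁆ = (⁅x, y⁆, 0) := by
    intro x y
    ext <;> simp
  have bracket5 : ∀ x : L, ⁅((0, 1) : L × ℝ), ((x, 0) : L × ℝ)⁆ = 0 := by
    intro x
    ext <;> simp
  have hp : ∀ i j k : Fin 4, ρ ![(e i.castSucc, 0), (e j.castSucc, 0), (e k.castSucc, 0)] = 0 := by
    let ψ := ρ.compLinearMap (LinearMap.inl ℝ L ℝ)
    have hψ' : ∀ x y z, ψ ![x, y, z] = ρ ![(x, 0), (y, 0), (z, 0)] := by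
      intro x y z
      change ρ _ = _
      congr 1
      ext k <;> fin_cases k <;> rfl
    have hψ : ceD L 2 ψ = 0 := by
      funext x
      have hx : x = ![x 0, x 1, x 2, x 3] := by
        ext k
        fin_cases k <;> rfl
      have := congrFun hρ ![(x 0, 0), (x 1, 0), (x 2, 0), (x 3, 0)]
      rw [ceD_two_apply] at this
      rw [hx, ceD_two_apply]
      simpa only [bracket, hψ', Pi.zero_apply] using this
    obtain ⟨η, hη⟩ := exists_ceD_one_eq hdim h3 hψ
    intro i j k
    rw [← hψ', ← hη, ceD_one_apply, hab, hab, hab]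
    simp [η.map_coord_zero (m := ![0, _]) (0 : Fin 2) rfl]
  have hw : ∀ i j : Fin 4, ρ ![(e i.castSucc, 0), (e j.castSucc, 0), (0, 1)] = 0 := by
    let ω := (ρ.curryLeft (0, 1)).compLinearMap (LinearMap.inl ℝ L ℝ)
    have hω' : ∀ x y, ω ![x, y] = ρ ![(0, 1), (x, 0), (y, 0)] := by
      intro x y
      change ρ _ = _
      congr 1
      ext k <;> fin_cases k <;> rfl
    have hω : ∀ x y z, ceD L 1 ω ![x, y, z] = 0 := by
      intro x y z
      have := congrFun hρ ![(0, 1), (x, 0), (y, 0), (z, 0)]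
      rw [ceD_two_apply, bracket5, bracket5, bracket5, bracket, bracket, bracket,
        map_swap_left ρ (0, 1), map_swap_left ρ (0, 1), map_swap_left ρ (0, 1)] at this
      rw [ceD_one_apply]
      simp only [hω', ρ.map_coord_zero (m := ![0, _, _]) (0 : Fin 3) rfl, Pi.zero_apply] at this ⊢
      linarith
    have hW : gram e ω = 0 := by
      refine skew_eq_zero (A := A) (fun M hM => ?_) (gram_transpose ω) ?_
      · obtain ⟨τ, hτ, hτM⟩ := exists_closed hab had hM
        obtain ⟨η, hη⟩ := exists_ceD_one_eq hdim h3 hτ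
        refine ⟨gram e η, gram_transpose η, ?_⟩
        ext i j
        rw [← ceD_one_basis hab had, hη, hτM]
      · ext i j
        rw [← ceD_one_basis hab had, hω]
        rfl
    intro i j
    rw [map_swap_right, map_swap_left, neg_neg, ← hω']
    exact congrFun (congrFun hW i) j
  intro b
  obtain ⟨c, hc⟩ := exists_quartic_eq_mul (prodBasis e) b ρ
  have hb : ∀ i : Fin 4, prodBasis e i.castSucc.castSucc = (e i.castSucc, 0) := 
    fun i => prodBasis_castSucc e _
  have Tp : ∀ i j k : Fin 4, comp (prodBasis e) ρ i.castSucc.castSucc j.castSucc.castSucc k.castSucc.castSucc = 0 := by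
    intro i j k
    rw [comp, hb, hb, hb, hp]
  have Tw : ∀ i j : Fin 4, comp (prodBasis e) ρ i.castSucc.castSucc j.castSucc.castSucc 5 = 0 := by
    intro i j
    rw [comp, hb, hb, prodBasis_five, hw]
  rw [hc, quartic_eq]
  have := Tp 0 1 2
  have := Tp 0 1 3
  have := Tp 0 2 3
  have := Tp 1 2 3
  have := Tw 0 1
  have := Tw 0 2
  have := Tw 0 3
  have := Tw 1 2
  have := Tw 1 3
  have := Tw 2 3
  simp_all

end HalfFlat

end

theorem proposition4p2 {L : Type*} [LieRing L] [LieAlgebra ℝ L]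
    (hdim : Module.finrank ℝ L = 5) (hind : HalfFlat.Indecomposable L)
    (ρ : (L × ℝ) [⋀^Fin 3]→ₗ[ℝ] ℝ) (hρ : HalfFlat.ceD (L × ℝ) 2 ρ = 0) :
    (HalfFlat.Marked L → HalfFlat.LambdaNonneg ρ) ∧
    (HalfFlat.NilradicalIsR4 L → HalfFlat.h3 L = 0 → HalfFlat.LambdaZero ρ) := by
  refine ⟨?_, fun hN h3 => HalfFlat.lambdaZero_of_h3_eq_zero hdim hρ hN h3⟩
  rintro ⟨e, A, h⟩ b
  have hdeg : HalfFlat.Degenerate (HalfFlat.comp (HalfFlat.prodBasis e) ρ) := by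
    rcases h with ⟨hA, he⟩ | ⟨hA, he⟩
    · exact hA.degenerate (he.closedComp hρ)
    · exact hA.degenerate (he.closedComp hρ)
  obtain ⟨c, hc⟩ := HalfFlat.exists_quartic_eq_mul (HalfFlat.prodBasis e) b ρ
  rw [hc]
  exact mul_nonneg (sq_nonneg c) hdeg.quartic_nonneg
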